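/- All graphs are finite and simple. A straight-line drawing of a graph $G$ maps its vertices to distinct points of the plane and each edge to the segment between its endpoints; its \emph{outer face} is the unbounded connected component of the complement of the drawing. The drawing is an \emph{outside-obstacle representation} (OOR) of $G$ if any two distinct vertices $u,v$ of $G$ are adjacent if and only if the segment between their points is disjoint from the outer face (that is, every non-edge intersects the outer face). It is \emph{regular} if the $n=|V(G)|$ vertices lie at the corners of a regular $n$-gon (a single point if $n=1$, the endpoints of a segment if $n=2$), and \emph{reducible} if every edge is incident to the outer face, i.e., some piece of positive length of the edge lies on the boundary of the outer face. A \emph{cactus} is a connected graph in which every edge is contained in at most one simple cycle. A \emph{grid} is the Cartesian product $P_k\square P_\ell$ of two simple paths with $k,\ell\ge 1$ vertices. An \emph{outerpath} is a graph that admits an outerplanar drawing (a crossing-free drawing with all vertices on the outer face) whose weak dual (the graph whose nodes are the inner faces, two of them being adjacent if they share an edge) is a path, possibly the path without vertices. **Theorem.** The following graphs have reducible regular OORs: (1) every cactus; (2) every grid; (3) every outerpath. -/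

import Mathlib

open SimpleGraph

/-! ### Straight-line drawings and outside-obstacle representations

The plane is `ℂ`. A straight-line drawing of a graph `G` on `V` is given by the positions
`pos : V → ℂ` of its vertices. -/

/-- The point set of the straight-line drawing: all vertices and all (closed) edge segments. -/
def drawing {V : Type*} (G : SimpleGraph V) (pos : V → ℂ) : Set ℂ :=
  Set.range pos ∪ {z | ∃ u v, G.Adj u v ∧ z ∈ segment ℝ (pos u) (pos v)}

/-- The outer face: the unbounded connected component of the complement of the drawing. -/
def outerFace {V : Type*} (G : SimpleGraph V) (pos : V → ℂ) : Set ℂ :=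
  {z | z ∈ (drawing G pos)ᶜ ∧
    ¬ Bornology.IsBounded (connectedComponentIn (drawing G pos)ᶜ z)}

/-- An outside-obstacle representation (OOR): the vertices are placed at distinct points, and `G`
is the visibility graph of these points with the whole outer face as the only obstacle, i.e. two
distinct vertices are adjacent exactly if the segment between them avoids the outer face. -/
def IsOOR {V : Type*} (G : SimpleGraph V) (pos : V → ℂ) : Prop :=
  Function.Injective pos ∧
    ∀ u v, u ≠ v → (G.Adj u v ↔ Disjoint (segment ℝ (pos u) (pos v)) (outerFace G pos))

/-- A drawing is reducible if each edge is incident to the outer face: some piece of the edge of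
positive length lies on the boundary of the outer face. -/
def IsReducible {V : Type*} (G : SimpleGraph V) (pos : V → ℂ) : Prop :=
  ∀ u v, G.Adj u v → ∃ a b : ℂ, a ≠ b ∧
    segment ℝ a b ⊆ segment ℝ (pos u) (pos v) ∧ segment ℝ a b ⊆ frontier (outerFace G pos)

/-- The `n = |V|` vertices are placed bijectively at the corners of a regular `n`-gon (with some
centre `c` and a first corner at `c + ρ`, `ρ ≠ 0`). -/
def IsRegularPolygon {V : Type*} [Fintype V] (pos : V → ℂ) : Prop :=
  ∃ (c ρ : ℂ) (σ : V ≃ Fin (Fintype.card V)), ρ ≠ 0 ∧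
    ∀ v, pos v = c + ρ * Complex.exp
      (2 * Real.pi * Complex.I * (((σ v : ℕ) : ℂ) / ((Fintype.card V : ℕ) : ℂ)))

/-- `G` has a reducible regular OOR. -/
def HasReducibleRegularOOR {V : Type*} [Fintype V] (G : SimpleGraph V) : Prop :=
  ∃ pos : V → ℂ, IsRegularPolygon pos ∧ IsOOR G pos ∧ IsReducible G pos

/-! ### The three graph classes -/

/-- A cactus: a connected graph in which any two simple cycles with a common edge are the same
cycle (as subgraphs). -/
def IsCactus {V : Type*} (G : SimpleGraph V) : Prop :=
  G.Connected ∧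
    ∀ (e : Sym2 V) (u v : V) (p : G.Walk u u) (q : G.Walk v v),
      p.IsCycle → q.IsCycle → e ∈ p.edges → e ∈ q.edges → p.toSubgraph = q.toSubgraph

/-- A grid: the Cartesian product of two (nonempty) simple paths, up to isomorphism. -/
def IsGrid {V : Type*} (G : SimpleGraph V) : Prop :=
  ∃ k l : ℕ, 1 ≤ k ∧ 1 ≤ l ∧ Nonempty (G ≃g (pathGraph k □ pathGraph l))

/-- An outerplanar drawing: the vertices are placed on a circle in the circular order given by `σ`
and the edges are drawn as chords (inside the circle), no two of which cross. -/
def IsOuterplanarDrawing {V : Type*} [Fintype V] (G : SimpleGraph V)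
    (σ : V ≃ Fin (Fintype.card V)) : Prop :=
  ∀ a b c d, G.Adj a c → G.Adj b d → ¬ (sbtw (σ a) (σ b) (σ c) ∧ sbtw (σ c) (σ d) (σ a))

/-- `x` and `y` are consecutive among the elements of `S` in the circular order: one of the two
open arcs between them contains no element of `S`. -/
def ConsecutiveIn {V : Type*} [Fintype V] (σ : V ≃ Fin (Fintype.card V)) (S : Finset V)
    (x y : V) : Prop :=
  (∀ z ∈ S, ¬ sbtw (σ x) (σ z) (σ y)) ∨ (∀ z ∈ S, ¬ sbtw (σ y) (σ z) (σ x))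

/-- The inner (bounded) faces of an outerplanar drawing, each given by the set `S` of its vertices.
As no two chords cross, each bounded face is the interior of a convex polygon with corners on the
circle, all of whose sides are edges and none of whose diagonals is an edge; conversely the
interior of such a polygon meets no edge at all, so it is a face. -/
def IsInnerFace {V : Type*} [Fintype V] (G : SimpleGraph V) (σ : V ≃ Fin (Fintype.card V))
    (S : Finset V) : Prop :=
  3 ≤ S.card ∧ ∀ x ∈ S, ∀ y ∈ S, x ≠ y → (G.Adj x y ↔ ConsecutiveIn σ S x y)

/-- The weak dual of an outerplanar drawing: the nodes are the inner faces, and two distinct inner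
faces are adjacent if some edge is on the boundary of both. (An edge with both ends on an inner
face is a side of it.) -/
def weakDual {V : Type*} [Fintype V] (G : SimpleGraph V) (σ : V ≃ Fin (Fintype.card V)) :
    SimpleGraph {S : Finset V // IsInnerFace G σ S} where
  Adj S T := S ≠ T ∧ ∃ x y, G.Adj x y ∧ x ∈ S.1 ∧ y ∈ S.1 ∧ x ∈ T.1 ∧ y ∈ T.1
  symm := ⟨fun _ _ ⟨h, x, y, hxy, hx, hy, hx', hy'⟩ => ⟨h.symm, x, y, hxy, hx', hy', hx, hy⟩⟩
  loopless := ⟨fun _ h => h.1 rfl⟩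

/-- An outerpath: a graph with an outerplanar drawing whose weak dual is a path. The drawing may
have no inner face at all (the path with no vertex). -/
def IsOuterpath {V : Type*} [Fintype V] (G : SimpleGraph V) : Prop :=
  ∃ σ : V ≃ Fin (Fintype.card V), IsOuterplanarDrawing G σ ∧
    ∃ m : ℕ, Nonempty (weakDual G σ ≃g pathGraph m)

/-! ### Visibility from a point of the circle -/

/-! Only the cyclic order of the vertices on the circle matters. Cut the circle at a gap. The chord
`uv` has a piece visible from that gap if no other chord covers it and every chord cutting off `u`
ends no later than any chord cutting off `v` begins (`Sees`). Such a piece can be joined to infinity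
through the gap. Hence it lies on the frontier of the outer face if `uv` is an edge, and inside the
outer face if it is not (`exists_segment_frontier`). So a cyclic order in which every pair is seen
from some gap (`HasGoodOrder`) settles the non-edges and reducibility at once, and it stays good
when edges are removed.

Good orders are then built combinatorially. They can be glued: if edges run only within fibres or
between the roots of fibres, each fibre becomes a block of consecutive vertices starting with its
root, and the blocks follow the order of the roots (`HasGoodOrder.glue`). An edge that is alone
across a cut is the case of two blocks.

A cactus is taken apart by deleting a bridge or all edges of a cycle. In the second case every
remaining component contains at most one vertex of the cycle, so it can be glued to a zigzag order
of the cycle. In a grid, edges join consecutive diagonals. With diagonals placed alternately on two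
rows, every pair is seen from a gap next to one of its ends.

In an outerpath, edges on no inner face are alone across some cut and are added last. The faces,
read along the path, form a strip: a time order on two rows in which no edge passes over a vertex in
the row of its earlier end. Putting each vertex on one of two sides, according to its row and the
parity of its time, gives a good order (`hasGoodOrder_strip`). -/

/-- In the linear order given by `g`, the pair `u, v` is visible from infinity with respect to the
chords in `E`: no other chord covers it, and any chord cutting off `u` ends before any chord
cutting off `v` begins. -/
def Sees {V α : Type*} [LinearOrder α] (E : V → V → Prop) (g : V → α) (u v : V) : Prop :=
  g u < g v ∧ (∀ x y, E x y → g x ≤ g u → g v ≤ g y → x = u ∧ y = v) ∧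
    ∀ x y x' y', E x y → E x' y' → g x < g u → g u < g y → g y < g v →
      g u < g x' → g x' < g v → g v < g y' → g y ≤ g x'

theorem Sees.congr {V α β : Type*} [LinearOrder α] [LinearOrder β] {E : V → V → Prop}
    {g : V → α} {g' : V → β} {u v : V} (h : ∀ x y, g x < g y ↔ g' x < g' y)
    (H : Sees E g u v) : Sees E g' u v := by
  have h' : ∀ x y, g x ≤ g y ↔ g' x ≤ g' y := fun x y => by
    rw [← not_lt, ← not_lt, h]
  simp only [Sees, h, h'] at H
  exact H

theorem Sees.mono {V α : Type*} [LinearOrder α] {E E' : V → V → Prop}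
    {g : V → α} {u v : V} (h : ∀ x y, E' x y → E x y) (H : Sees E g u v) : Sees E' g u v :=
  ⟨H.1, fun x y hxy => H.2.1 x y (h _ _ hxy),
    fun x y x' y' h1 h2 => H.2.2 x y x' y' (h _ _ h1) (h _ _ h2)⟩

/-! ### Signed areas and points of the circle -/

/-- Twice the signed area of the triangle `a b z`. -/
def orient (a b z : ℂ) : ℝ := (b.re - a.re) * (z.im - a.im) - (b.im - a.im) * (z.re - a.re)

/-- The point of the unit circle at angle `t`. -/
noncomputable def circlePt (t : ℝ) : ℂ := ⟨Real.cos t, Real.sin t⟩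

theorem orient_circlePt (a b c : ℝ) : orient (circlePt a) (circlePt b) (circlePt c) =
    4 * Real.sin ((b - a) / 2) * Real.sin ((c - b) / 2) * Real.sin ((c - a) / 2) := by
  obtain ⟨x, rfl⟩ : ∃ x, a = 2 * x := ⟨a / 2, by ring⟩
  obtain ⟨y, rfl⟩ : ∃ x, b = 2 * x := ⟨b / 2, by ring⟩
  obtain ⟨z, rfl⟩ : ∃ x, c = 2 * x := ⟨c / 2, by ring⟩
  have e1 : (2 * y - 2 * x) / 2 = y - x := by ring
  have e2 : (2 * z - 2 * y) / 2 = z - y := by ring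
  have e3 : (2 * z - 2 * x) / 2 = z - x := by ring
  rw [e1, e2, e3]
  simp only [orient, circlePt, Real.sin_sub, Real.sin_two_mul, Real.cos_two_mul]
  have hx := Real.sin_sq_add_cos_sq x
  have hy := Real.sin_sq_add_cos_sq y
  have hz := Real.sin_sq_add_cos_sq z
  set sx := Real.sin x; set cx := Real.cos x
  set sy := Real.sin y; set cy := Real.cos y
  set sz := Real.sin z; set cz := Real.cos z
  grind

theorem orient_circlePt_pos {a b c : ℝ} (hab : a < b) (hbc : b < c) (hac : c < a + 2 * Real.pi) :
    0 < orient (circlePt a) (circlePt b) (circlePt c) := by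
  rw [orient_circlePt]
  have h1 : 0 < Real.sin ((b - a) / 2) :=
    Real.sin_pos_of_pos_of_lt_pi (by linarith) (by linarith)
  have h2 : 0 < Real.sin ((c - b) / 2) :=
    Real.sin_pos_of_pos_of_lt_pi (by linarith) (by linarith)
  have h3 : 0 < Real.sin ((c - a) / 2) :=
    Real.sin_pos_of_pos_of_lt_pi (by linarith) (by linarith)
  positivity

theorem orient_rot (a b c : ℂ) : orient a b c = orient c a b := by unfold orient; ring
theorem orient_swap (a b c : ℂ) : orient a b c = - orient a c b := by unfold orient; ring
theorem orient_left (a b : ℂ) : orient a b a = 0 := by unfold orient; ring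
theorem orient_right (a b : ℂ) : orient a b b = 0 := by unfold orient; ring

theorem orient_lineMap (a b z w : ℂ) (s : ℝ) :
    orient a b (AffineMap.lineMap z w s) = (1 - s) * orient a b z + s * orient a b w := by
  simp only [orient, AffineMap.lineMap_apply, vsub_eq_sub, vadd_eq_add, Complex.add_re,
    Complex.add_im, Complex.real_smul, Complex.mul_re, Complex.mul_im, Complex.ofReal_re,
    Complex.ofReal_im, Complex.sub_re, Complex.sub_im]
  ring

theorem orient_eq_zero_of_mem_segment {a b z : ℂ} (h : z ∈ segment ℝ a b) : orient a b z = 0 := by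
  rw [segment_eq_image_lineMap] at h
  obtain ⟨s, -, rfl⟩ := h
  rw [orient_lineMap, orient_left, orient_right]; ring

/-- Up to sign, both sides are the determinant of the lines `uv`, `xy`, `ab`, which vanishes if they
are concurrent. Its sign decides which of `xy` and `ab` meets `uv` first. -/
theorem orient_pluecker (u v x y a b : ℂ) :
    orient x y v * orient a b u - orient x y u * orient a b v =
      orient u v x * orient a b y - orient u v y * orient a b x := by
  unfold orient; ring

theorem exists_between_finite {A B : Set ℝ} (hA : A.Finite) (hB : B.Finite) (hA0 : A.Nonempty)
    (hB0 : B.Nonempty) (h : ∀ a ∈ A, ∀ b ∈ B, a < b) :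
    ∃ s t, s < t ∧ (∀ a ∈ A, a < s) ∧ ∀ b ∈ B, t < b := by
  obtain ⟨a, ha, ha'⟩ := hA.exists_maximal hA0
  obtain ⟨b, hb, hb'⟩ := hB.exists_minimal hB0
  have hab := h a ha b hb
  refine ⟨a + (b - a) / 3, a + 2 * (b - a) / 3, by linarith, fun x hx => ?_, fun x hx => ?_⟩
  · rcases le_total x a with h1 | h1
    · linarith
    · linarith [ha' hx h1]
  · rcases le_total b x with h1 | h1
    · linarith
    · linarith [hb' hx h1]

/-! ### The visible piece of a chord -/

section Circle

variable {V : Type*} {E : V → V → Prop} {θ : V → ℝ} {φ : ℝ}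

/-- Sign convention: with ends listed in increasing angle, a chord is negative on the arc it cuts
off and positive on the arc that contains the cut `φ`. -/
theorem orient_lt_between (hφ : ∀ v, φ < θ v ∧ θ v < φ + 2 * Real.pi) {x y w : V}
    (h1 : θ x < θ w) (h2 : θ w < θ y) :
    orient (circlePt (θ x)) (circlePt (θ y)) (circlePt (θ w)) < 0 := by
  rw [orient_swap]
  linarith [orient_circlePt_pos h1 h2 (by linarith [(hφ x).1, (hφ y).2])]

theorem orient_pos_outside (hφ : ∀ v, φ < θ v ∧ θ v < φ + 2 * Real.pi) {x y w : V}
    (h : θ x < θ y) (h1 : θ w < θ x ∨ θ y < θ w) :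
    0 < orient (circlePt (θ x)) (circlePt (θ y)) (circlePt (θ w)) := by
  rcases h1 with h1 | h1
  · rw [orient_rot]
    exact orient_circlePt_pos h1 h (by linarith [(hφ w).1, (hφ y).2])
  · exact orient_circlePt_pos h h1 (by linarith [(hφ x).1, (hφ w).2])

theorem orient_pos_cut (hφ : ∀ v, φ < θ v ∧ θ v < φ + 2 * Real.pi) {x y : V}
    (h : θ x < θ y) : 0 < orient (circlePt (θ x)) (circlePt (θ y)) (circlePt φ) := by
  rw [orient_rot]
  exact orient_circlePt_pos (hφ x).1 h (hφ y).2

/-- A visible pair has a subsegment all of whose points lie on the cut's side of all other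
chords. -/
theorem exists_visible_subsegment [Finite V] (hθ : Function.Injective θ)
    (hφ : ∀ v, φ < θ v ∧ θ v < φ + 2 * Real.pi) {u v : V} (H : Sees E θ u v) :
    ∃ s t : ℝ, 0 < s ∧ s < t ∧ t < 1 ∧ ∀ r, s ≤ r → r ≤ t → ∀ x y, E x y → θ x < θ y →
      ¬ (x = u ∧ y = v) →
      0 < orient (circlePt (θ x)) (circlePt (θ y))
        (AffineMap.lineMap (circlePt (θ u)) (circlePt (θ v)) r) := by
  obtain ⟨huv, hc, hx⟩ := H
  set P : V → ℂ := fun v => circlePt (θ v) with hP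
  let D : V × V → V → ℝ := fun e w => orient (P e.1) (P e.2) (P w)
  -- `A` holds the parameters on `uv` where chords cutting off `u` cross it, `B` those of chords
  -- cutting off `v`. The extra elements `0` and `1` keep both sets nonempty and force `0 < s` and
  -- `t < 1`.
  let A : Set ℝ := insert 0 ((fun e => D e u / (D e u - D e v)) ''
    {e : V × V | E e.1 e.2 ∧ θ e.1 < θ u ∧ θ u < θ e.2 ∧ θ e.2 < θ v})
  let B : Set ℝ := insert 1 ((fun e => D e u / (D e u - D e v)) ''
    {e : V × V | E e.1 e.2 ∧ θ u < θ e.1 ∧ θ e.1 < θ v ∧ θ v < θ e.2})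
  have key1 : ∀ e : V × V, E e.1 e.2 → θ e.1 < θ u → θ u < θ e.2 → θ e.2 < θ v →
      D e u < 0 ∧ 0 < D e v := fun e _ h2 h3 h4 =>
    ⟨orient_lt_between hφ h2 h3, orient_pos_outside hφ (h2.trans h3) (Or.inr h4)⟩
  have key2 : ∀ e : V × V, E e.1 e.2 → θ u < θ e.1 → θ e.1 < θ v → θ v < θ e.2 →
      0 < D e u ∧ D e v < 0 := fun e _ h2 h3 h4 =>
    ⟨orient_pos_outside hφ (h3.trans h4) (Or.inl h2), orient_lt_between hφ h3 h4⟩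
  obtain ⟨s, t, hst, hA, hB⟩ := exists_between_finite (A := A) (B := B)
    ((Set.toFinite _).insert _) ((Set.toFinite _).insert _) ⟨0, by simp [A]⟩ ⟨1, by simp [B]⟩ (by
      rintro a (rfl | ⟨e, ⟨h1, h2, h3, h4⟩, rfl⟩) b (rfl | ⟨e', ⟨h1', h2', h3', h4'⟩, rfl⟩)
      · norm_num
      · obtain ⟨k1, k2⟩ := key2 e' h1' h2' h3' h4'
        exact div_pos k1 (by linarith)
      · obtain ⟨k1, k2⟩ := key1 e h1 h2 h3 h4
        change D e u / (D e u - D e v) < 1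
        rw [div_lt_one_of_neg (by linarith)]
        linarith
      · obtain ⟨k1, k2⟩ := key1 e h1 h2 h3 h4
        obtain ⟨k1', k2'⟩ := key2 e' h1' h2' h3' h4'
        change D e u / (D e u - D e v) < D e' u / (D e' u - D e' v)
        have hle := hx _ _ _ _ h1 h1' h2 h3 h4 h2' h3' h4'
        have p1 : 0 < orient (P u) (P v) (P e.1) := orient_pos_outside hφ huv (Or.inl h2)
        have p2 : orient (P u) (P v) (P e.2) < 0 := orient_lt_between hφ h3 h4
        have p3 : 0 < orient (P e'.1) (P e'.2) (P e.1) :=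
          orient_pos_outside hφ (h3'.trans h4') (Or.inl (h2.trans h2'))
        have p4 : 0 ≤ orient (P e'.1) (P e'.2) (P e.2) := by
          -- The two chords may share an end on the circle, so this sign is only weak. The product
          -- with `p2` and `p3` supplies strictness.
          rcases hle.lt_or_eq with h | h
          · exact (orient_pos_outside hφ (h3'.trans h4') (Or.inl h)).le
          · rw [hθ h, orient_left]
        -- Cleared of denominators, the inequality of parameters is the positivity of the left side
        -- of this identity. The signs of the right side are `p1` to `p4`.
        have := orient_pluecker (P u) (P v) (P e.1) (P e.2) (P e'.1) (P e'.2)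
        have h5 : 0 < D e v * D e' u - D e u * D e' v := by
          change 0 < orient _ _ _ * orient _ _ _ - orient _ _ _ * orient _ _ _
          rw [this]
          nlinarith [mul_nonneg p1.le p4, mul_pos (neg_pos.2 p2) p3]
        rw [← neg_div_neg_eq, div_lt_div_iff₀ (by linarith) (by linarith)]
        nlinarith)
  refine ⟨s, t, hA 0 (by simp [A]), hst, hB 1 (by simp [B]), fun r hr1 hr2 x y hE hxy hne => ?_⟩
  have hs0 : 0 < r := (hA 0 (by simp [A])).trans_le hr1
  have ht1 : r < 1 := hr2.trans_lt (hB 1 (by simp [B]))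
  rw [orient_lineMap]
  change 0 < (1 - r) * D (x, y) u + r * D (x, y) v
  have hDu : θ u < θ x ∨ θ y < θ u → 0 < D (x, y) u := orient_pos_outside hφ hxy
  have hDv : θ v < θ x ∨ θ y < θ v → 0 < D (x, y) v := orient_pos_outside hφ hxy
  have hux : θ x = θ u → D (x, y) u = 0 := fun h => by rw [← hθ h]; exact orient_left _ _
  have huy : θ y = θ u → D (x, y) u = 0 := fun h => by rw [← hθ h]; exact orient_right _ _
  have hvx : θ x = θ v → D (x, y) v = 0 := fun h => by rw [← hθ h]; exact orient_left _ _
  have hvy : θ y = θ v → D (x, y) v = 0 := fun h => by rw [← hθ h]; exact orient_right _ _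
  have hpos : ∀ a b : ℝ, 0 ≤ a → 0 ≤ b → 0 < a ∨ 0 < b → 0 < (1 - r) * a + r * b := by
    rintro a b ha hb (h | h)
    · have := mul_pos (sub_pos.2 ht1) h
      have := mul_nonneg hs0.le hb
      linarith
    · have := mul_nonneg (sub_pos.2 ht1).le ha
      have := mul_pos hs0 h
      linarith
  rcases lt_trichotomy (θ x) (θ u) with h1 | h1 | h1
  · have hyv : θ y < θ v := by
      by_contra h
      exact hne (hc x y hE h1.le (not_lt.1 h))
    rcases lt_trichotomy (θ y) (θ u) with h2 | h2 | h2
    · exact hpos _ _ (hDu (Or.inr h2)).le (hDv (Or.inr hyv)).le (Or.inr (hDv (Or.inr hyv)))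
    · exact hpos _ _ (huy h2).ge (hDv (Or.inr hyv)).le (Or.inr (hDv (Or.inr hyv)))
    · have : D (x, y) u / (D (x, y) u - D (x, y) v) < s :=
        hA _ (Set.mem_insert_of_mem _ ⟨(x, y), ⟨hE, h1, h2, hyv⟩, rfl⟩)
      obtain ⟨k1, k2⟩ := key1 (x, y) hE h1 h2 hyv
      rw [← neg_div_neg_eq, div_lt_iff₀ (by linarith)] at this
      nlinarith
  · have hyv : θ y < θ v := by
      by_contra h
      exact hne (hc x y hE h1.le (not_lt.1 h))
    exact hpos _ _ (hux h1).ge (hDv (Or.inr hyv)).le (Or.inr (hDv (Or.inr hyv)))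
  · have hu := hDu (Or.inl h1)
    rcases lt_trichotomy (θ x) (θ v) with h2 | h2 | h2
    · rcases lt_trichotomy (θ y) (θ v) with h3 | h3 | h3
      · exact hpos _ _ hu.le (hDv (Or.inr h3)).le (Or.inl hu)
      · exact hpos _ _ hu.le (hvy h3).ge (Or.inl hu)
      · have : t < D (x, y) u / (D (x, y) u - D (x, y) v) :=
          hB _ (Set.mem_insert_of_mem _ ⟨(x, y), ⟨hE, h1, h2, h3⟩, rfl⟩)
        obtain ⟨k1, k2⟩ := key2 (x, y) hE h1 h2 h3
        rw [lt_div_iff₀ (by linarith)] at this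
        nlinarith
    · exact hpos _ _ hu.le (hvx h2).ge (Or.inl hu)
    · exact hpos _ _ hu.le (hDv (Or.inl h2)).le (Or.inl hu)

end Circle

/-! ### Reaching infinity through the cut -/

theorem mem_outerFace_of_isPreconnected {V : Type*} {G : SimpleGraph V} {pos : V → ℂ} {S : Set ℂ}
    {z : ℂ} (hS : IsPreconnected S) (hz : z ∈ S) (hd : S ⊆ (drawing G pos)ᶜ)
    (hb : ¬ Bornology.IsBounded S) : z ∈ outerFace G pos :=
  ⟨hd hz, fun h => hb (h.subset (hS.subset_connectedComponentIn hz hd))⟩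

theorem norm_circlePt (t : ℝ) : ‖circlePt t‖ = 1 := by
  rw [← sq_eq_sq₀ (norm_nonneg _) zero_le_one, ← Complex.normSq_eq_norm_sq, Complex.normSq_apply]
  simp only [circlePt]
  nlinarith [Real.sin_sq_add_cos_sq t]

/-- A chord stays in the closed unit disc, so the outward ray could meet it only at `r = 1`, and
there the orientation is nonzero. -/
theorem orient_smul_circle {a b : ℂ} {φ r : ℝ} (ha : ‖a‖ = 1) (hb : ‖b‖ = 1) (hr : 1 ≤ r)
    (h : 0 < orient a b (circlePt φ)) : (r : ℂ) * circlePt φ ∉ segment ℝ a b := by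
  intro hz
  have h0 := orient_eq_zero_of_mem_segment hz
  have hn : ‖(r : ℂ) * circlePt φ‖ ≤ 1 := by
    have : segment ℝ a b ⊆ Metric.closedBall 0 1 :=
      (convex_closedBall (0 : ℂ) 1).segment_subset (by simp [ha]) (by simp [hb])
    simpa using this hz
  rw [norm_mul, norm_circlePt, mul_one, Complex.norm_real, Real.norm_eq_abs] at hn
  have : r = 1 := le_antisymm ((le_abs_self r).trans hn) hr
  rw [this, Complex.ofReal_one, one_mul] at h0
  exact h.ne' h0

section

variable {V : Type*} {G : SimpleGraph V} {θ : V → ℝ} {φ : ℝ}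

theorem ray_subset_compl_drawing (hθ : Function.Injective θ)
    (hφ : ∀ v, φ < θ v ∧ θ v < φ + 2 * Real.pi) :
    (fun r : ℝ => (r : ℂ) * circlePt φ) '' Set.Ici 1 ⊆ (drawing G (fun v => circlePt (θ v)))ᶜ := by
  rintro _ ⟨r, hr, rfl⟩ (⟨v, hv⟩ | ⟨x, y, hxy, hz⟩)
  · have h1 := congrArg norm hv
    simp only [norm_circlePt, norm_mul, mul_one, Complex.norm_real, Real.norm_eq_abs] at h1
    rw [abs_of_nonneg (zero_le_one.trans hr)] at h1
    replace hv : circlePt (θ v) = circlePt φ := by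
      simpa [← h1] using hv
    have hc := congrArg Complex.re hv
    have hs := congrArg Complex.im hv
    simp only [circlePt] at hc hs
    have : Real.cos (θ v - φ) = 1 := by
      rw [Real.cos_sub, hc, hs]; nlinarith [Real.sin_sq_add_cos_sq φ]
    rw [Real.cos_eq_one_iff_of_lt_of_lt (by linarith [(hφ v).1, Real.pi_pos])
      (by linarith [(hφ v).2])] at this
    linarith [(hφ v).1]
  · rcases lt_or_gt_of_ne (hθ.ne hxy.ne) with h | h
    · exact orient_smul_circle (norm_circlePt _) (norm_circlePt _) hr (orient_pos_cut hφ h) hz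
    · rw [segment_symm] at hz
      exact orient_smul_circle (norm_circlePt _) (norm_circlePt _) hr (orient_pos_cut hφ h) hz

theorem not_isBounded_ray :
    ¬ Bornology.IsBounded ((fun r : ℝ => (r : ℂ) * circlePt φ) '' Set.Ici 1) := by
  intro h
  obtain ⟨C, hC⟩ := h.exists_norm_le
  have := hC _ ⟨|C| + 1, by simp, rfl⟩
  rw [norm_mul, norm_circlePt, mul_one, Complex.norm_real, Real.norm_eq_abs,
    abs_of_nonneg (by positivity)] at this
  linarith [le_abs_self C]

/-- Each chord has `z` and the cut point strictly on the same side. The segment from `z` to the cut,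
continued by the outward ray, is therefore a connected unbounded set missing the drawing. -/
theorem mem_outerFace_of_orient_pos (hθ : Function.Injective θ)
    (hφ : ∀ v, φ < θ v ∧ θ v < φ + 2 * Real.pi) {z : ℂ} (hn : ‖z‖ < 1)
    (hz : ∀ x y, G.Adj x y → θ x < θ y → 0 < orient (circlePt (θ x)) (circlePt (θ y)) z) :
    z ∈ outerFace G (fun v => circlePt (θ v)) := by
  set ray : Set ℂ := (fun r : ℝ => (r : ℂ) * circlePt φ) '' Set.Ici 1
  have hray : IsPreconnected ray := isPreconnected_Ici.image _ (by fun_prop)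
  have h1 : circlePt φ ∈ ray := ⟨1, by simp, by simp⟩
  refine mem_outerFace_of_isPreconnected (S := segment ℝ z (circlePt φ) ∪ ray)
    (IsPreconnected.union (circlePt φ) (right_mem_segment _ _ _) h1
      (convex_segment _ _).isPreconnected hray) (Or.inl (left_mem_segment _ _ _))
    (Set.union_subset ?_ (ray_subset_compl_drawing hθ hφ))
    fun h => not_isBounded_ray (h.subset Set.subset_union_right)
  have hor : ∀ x y, G.Adj x y → θ x < θ y → ∀ w ∈ segment ℝ z (circlePt φ),
      w ∉ segment ℝ (circlePt (θ x)) (circlePt (θ y)) := by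
    intro x y hxy hlt w hw hw'
    have h0 := orient_eq_zero_of_mem_segment hw'
    rw [segment_eq_image_lineMap] at hw
    obtain ⟨s, ⟨hs0, hs1⟩, rfl⟩ := hw
    rw [orient_lineMap] at h0
    have ha := hz x y hxy hlt
    have hb := orient_pos_cut hφ hlt
    rcases hs0.eq_or_lt with rfl | h
    · linarith
    · nlinarith [mul_pos h hb, mul_nonneg (sub_nonneg.2 hs1) ha.le]
  rintro w hw (⟨v, rfl⟩ | ⟨x, y, hxy, hw'⟩)
  · have hw0 := hw
    rw [segment_eq_image_lineMap] at hw
    obtain ⟨s, ⟨hs0, hs1⟩, hs⟩ := hw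
    simp only [AffineMap.lineMap_apply_module] at hs
    have hn1 := norm_add_le ((1 - s) • z) (s • circlePt φ)
    rw [hs, norm_circlePt, norm_smul, norm_smul, norm_circlePt, Real.norm_eq_abs, Real.norm_eq_abs,
      abs_of_nonneg hs0, abs_of_nonneg (sub_nonneg.2 hs1)] at hn1
    have : s = 1 := by
      by_contra hne
      have : s < 1 := lt_of_le_of_ne hs1 hne
      nlinarith [mul_lt_mul_of_pos_left hn (sub_pos.2 this)]
    subst this
    simp only [sub_self, zero_smul, one_smul, zero_add] at hs
    exact ray_subset_compl_drawing (G := G) hθ hφ h1 (hs ▸ Or.inl ⟨v, rfl⟩)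
  · rcases lt_or_gt_of_ne (hθ.ne hxy.ne) with h | h
    · exact hor x y hxy h w hw hw'
    · rw [segment_symm] at hw'
      exact hor y x hxy.symm h w hw hw'

/-- The visible piece is on the cut's side of every chord except possibly `uv` itself. If `uv` is an
edge, its points are limits of points pushed slightly towards the cut, which are in the outer face.
-/
theorem exists_segment_frontier [Finite V] (hθ : Function.Injective θ)
    (hφ : ∀ v, φ < θ v ∧ θ v < φ + 2 * Real.pi) {u v : V} (H : Sees G.Adj θ u v) :
    ∃ a b : ℂ, a ≠ b ∧ segment ℝ a b ⊆ segment ℝ (circlePt (θ u)) (circlePt (θ v)) ∧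
      (G.Adj u v → segment ℝ a b ⊆ frontier (outerFace G (fun v => circlePt (θ v)))) ∧
      (¬ G.Adj u v → segment ℝ a b ⊆ outerFace G (fun v => circlePt (θ v))) := by
  obtain ⟨s, t, hs0, hst, ht1, h⟩ := exists_visible_subsegment hθ hφ H
  set U := circlePt (θ u) with hU
  set W := circlePt (θ v) with hW
  have huv := H.1
  have hUW : U ≠ W := by
    intro hUW
    have := orient_pos_cut hφ huv
    rw [← hU, ← hW, hUW, orient_rot, orient_right] at this
    exact this.false
  have hseg : ∀ z ∈ segment ℝ (AffineMap.lineMap U W s : ℂ) (AffineMap.lineMap U W t),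
      ∃ r, s ≤ r ∧ r ≤ t ∧ AffineMap.lineMap U W r = z := by
    intro z hz
    have : segment ℝ (AffineMap.lineMap U W s : ℂ) (AffineMap.lineMap U W t) =
        (AffineMap.lineMap U W : ℝ →ᵃ[ℝ] ℂ) '' segment ℝ s t := (image_segment _ _ _ _).symm
    rw [this, segment_eq_Icc hst.le] at hz
    obtain ⟨r, ⟨h1, h2⟩, rfl⟩ := hz
    exact ⟨r, h1, h2, rfl⟩
  have hball : ∀ r, s ≤ r → r ≤ t → ‖(AffineMap.lineMap U W r : ℂ)‖ < 1 := by
    intro r h1 h2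
    have : (AffineMap.lineMap U W r : ℂ) ∈ Metric.ball (0 : ℂ) 1 := by
      have hsc := strictConvex_closedBall ℝ (0 : ℂ) 1
      rw [← interior_closedBall (0 : ℂ) one_ne_zero]
      have := hsc (x := U) (y := W) (by simp [hU, norm_circlePt]) (by simp [hW, norm_circlePt]) hUW
        (a := 1 - r) (b := r) (by linarith) (by linarith) (by ring)
      rwa [AffineMap.lineMap_apply_module]
    simpa using this
  refine ⟨AffineMap.lineMap U W s, AffineMap.lineMap U W t, ?_, ?_, ?_, ?_⟩
  · intro h
    exact hst.ne (AffineMap.lineMap_injective ℝ hUW h)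
  · intro z hz
    obtain ⟨r, h1, h2, rfl⟩ := hseg z hz
    rw [segment_eq_image_lineMap]
    exact ⟨r, ⟨by linarith, by linarith⟩, rfl⟩
  · intro hadj z hz
    obtain ⟨r, h1, h2, rfl⟩ := hseg z hz
    set z : ℂ := AffineMap.lineMap U W r
    have hzseg : z ∈ segment ℝ U W := by
      rw [segment_eq_image_lineMap]
      exact ⟨r, ⟨by linarith, by linarith⟩, rfl⟩
    have hzd : z ∈ drawing G (fun v => circlePt (θ v)) := Or.inr ⟨u, v, hadj, hzseg⟩
    refine ⟨?_, fun hi => (interior_subset hi).1 hzd⟩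
    have hlim : Filter.Tendsto (fun ε : ℝ => (AffineMap.lineMap z (circlePt φ) ε : ℂ))
        (nhdsWithin 0 (Set.Ioi 0)) (nhds z) := by
      have : Filter.Tendsto (fun ε : ℝ => (AffineMap.lineMap z (circlePt φ) ε : ℂ))
        (nhds 0) (nhds (AffineMap.lineMap z (circlePt φ) (0 : ℝ))) :=
        (AffineMap.lineMap_continuous).tendsto 0
      rw [AffineMap.lineMap_apply_zero] at this
      exact this.mono_left nhdsWithin_le_nhds
    refine mem_closure_of_tendsto hlim ?_
    filter_upwards [Ioo_mem_nhdsGT (zero_lt_one' ℝ)] with ε hε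
    refine mem_outerFace_of_orient_pos hθ hφ ?_ fun x y hxy hlt => ?_
    · rw [AffineMap.lineMap_apply_module]
      refine (norm_add_le _ _).trans_lt ?_
      rw [norm_smul, norm_smul, norm_circlePt, Real.norm_eq_abs, Real.norm_eq_abs,
        abs_of_pos hε.1, abs_of_pos (sub_pos.2 hε.2)]
      nlinarith [mul_lt_mul_of_pos_left (hball r h1 h2) (sub_pos.2 hε.2)]
    · rw [orient_lineMap]
      have hc := mul_pos hε.1 (orient_pos_cut hφ hlt)
      have hz' : 0 ≤ orient (circlePt (θ x)) (circlePt (θ y)) z := by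
        by_cases he : x = u ∧ y = v
        · rw [he.1, he.2, orient_eq_zero_of_mem_segment hzseg]
        · exact (h r h1 h2 x y hxy hlt he).le
      have := mul_nonneg (sub_pos.2 hε.2).le hz'
      linarith
  · intro hadj z hz
    obtain ⟨r, h1, h2, rfl⟩ := hseg z hz
    exact mem_outerFace_of_orient_pos hθ hφ (hball r h1 h2) fun x y hxy hlt =>
      h r h1 h2 x y hxy hlt fun he => hadj (he.1 ▸ he.2 ▸ hxy)

end

/-! ### Cyclic orders seeing all pairs, and their drawings -/

/-- The integers of `[0, N)` read cyclically from `t` on. -/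
def rot (N t a : ℤ) : ℤ := if a < t then a + N else a

/-- Some rotation of the cyclic order `f` makes the pair `u, v` visible from infinity. -/
def PairSeen {V : Type*} (E : V → V → Prop) (f : V → ℤ) (N : ℤ) (u v : V) : Prop :=
  ∃ t, 0 ≤ t ∧ t ≤ N ∧
    (Sees E (fun w => rot N t (f w)) u v ∨ Sees E (fun w => rot N t (f w)) v u)

/-- `G` has a cyclic vertex order in which every pair of vertices is visible from some gap. -/
def HasGoodOrder {V : Type*} (G : SimpleGraph V) : Prop :=
  ∃ (f : V → ℤ) (N : ℤ), Function.Injective f ∧ (∀ v, 0 ≤ f v ∧ f v < N) ∧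
    ∀ u v, u ≠ v → PairSeen G.Adj f N u v

/-- Edges occur in `Sees` only as obstructions, and pairs must be seen whether adjacent or not. -/
theorem HasGoodOrder.mono {V : Type*} {G G' : SimpleGraph V} (h : G' ≤ G) (H : HasGoodOrder G) :
    HasGoodOrder G' := by
  obtain ⟨f, N, hf, hN, H⟩ := H
  refine ⟨f, N, hf, hN, fun u v huv => ?_⟩
  obtain ⟨t, h0, h1, ht⟩ := H u v huv
  exact ⟨t, h0, h1, ht.imp (Sees.mono fun _ _ e => h e) (Sees.mono fun _ _ e => h e)⟩

theorem PairSeen.symm {V : Type*} {E : V → V → Prop} {f : V → ℤ} {N : ℤ} {u v : V}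
    (h : PairSeen E f N u v) : PairSeen E f N v u := by
  obtain ⟨t, h0, h1, ht⟩ := h
  exact ⟨t, h0, h1, ht.symm⟩

theorem exists_equiv_fin_lt_iff {V : Type*} [Fintype V] {f : V → ℤ} (hf : Function.Injective f) :
    ∃ σ : V ≃ Fin (Fintype.card V), ∀ u v, σ u < σ v ↔ f u < f v := by
  let _ := LinearOrder.lift' f hf
  let e : V ≃o Fin (Fintype.card V) := (Fintype.orderIsoFinOfCardEq V rfl).symm
  exact ⟨e.toEquiv, fun u v => e.lt_iff_lt⟩

theorem circlePt_eq_exp (t : ℝ) : circlePt t = Complex.exp (t * Complex.I) := by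
  rw [Complex.exp_mul_I]
  apply Complex.ext
  · simp [circlePt, Complex.cos_ofReal_re]
  · simp [circlePt, Complex.sin_ofReal_re, Complex.cos_ofReal_im]

theorem circlePt_add_two_pi (t : ℝ) : circlePt (t + 2 * Real.pi) = circlePt t := by
  simp [circlePt]

/-- A good order gives a reducible regular outside-obstacle representation. -/
theorem HasGoodOrder.hasReducibleRegularOOR {V : Type*} [Fintype V] {G : SimpleGraph V}
    (H : HasGoodOrder G) : HasReducibleRegularOOR G := by
  obtain ⟨f, N, hf, hN, H⟩ := H
  obtain ⟨σ, hσ⟩ := exists_equiv_fin_lt_iff hf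
  set ψ : V → ℝ := fun v => 2 * Real.pi * ((σ v : ℕ) : ℝ) / Fintype.card V with hψ
  set pos : V → ℂ := fun v => circlePt (ψ v) with hpos
  have hnpos : ∀ v : V, (0 : ℝ) < Fintype.card V := fun v => by
    exact_mod_cast Fintype.card_pos_iff.2 ⟨v⟩
  have hψlt : ∀ u v, ψ u < ψ v ↔ f u < f v := by
    intro u v
    rw [← hσ, hψ]
    have := hnpos u
    simp only
    rw [div_lt_div_iff_of_pos_right this, mul_lt_mul_iff_right₀ (by positivity), Nat.cast_lt,
      Fin.lt_def]
  have hψr : ∀ v, 0 ≤ ψ v ∧ ψ v < 2 * Real.pi := by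
    intro v
    have := hnpos v
    refine ⟨by simp only [hψ]; positivity, ?_⟩
    simp only [hψ]
    rw [div_lt_iff₀ this, mul_lt_mul_iff_right₀ (by positivity), Nat.cast_lt]
    exact (σ v).2
  have main : ∀ u v, u ≠ v → ∃ a b : ℂ, a ≠ b ∧ segment ℝ a b ⊆ segment ℝ (pos u) (pos v) ∧
      (G.Adj u v → segment ℝ a b ⊆ frontier (outerFace G pos)) ∧
      (¬ G.Adj u v → segment ℝ a b ⊆ outerFace G pos) := by
    intro u v huv
    obtain ⟨t, -, -, ht⟩ := H u v huv
    -- Adding a full turn to the angles before `t` leaves the points fixed and makes the order of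
    -- the angles that of `rot N t ∘ f`.
    let θ : V → ℝ := fun v => ψ v + if f v < t then 2 * Real.pi else 0
    have hpθ : pos = fun v => circlePt (θ v) := by
      funext v
      by_cases h : f v < t
      · simp [hpos, θ, h, circlePt_add_two_pi]
      · simp [hpos, θ, h]
    have hlt : ∀ x y, rot N t (f x) < rot N t (f y) ↔ θ x < θ y := by
      intro x y
      have := hN x; have := hN y; have := hψr x; have := hψr y; have := hψlt x y
      simp only [rot, θ]
      split_ifs
      · rw [add_lt_add_iff_right, add_lt_add_iff_right, hψlt]
      · constructor <;> intro <;> [omega; linarith]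
      · constructor <;> intro <;> [linarith; omega]
      · rw [add_zero, add_zero, hψlt]
    have hθ : Function.Injective θ := by
      intro x y hxy
      have h1 := (hlt x y).not.2 hxy.not_lt
      have h2 := (hlt y x).not.2 hxy.not_gt
      have := hN x; have := hN y
      apply hf
      simp only [rot] at h1 h2
      split_ifs at h1 h2 <;> omega
    -- All angles lie within less than one turn of each other, so a direction `φ` fits in the gap
    -- between the last vertex and the first.
    obtain ⟨φ, _, h0, h1, h2⟩ := exists_between_finite (A := Set.range fun v => θ v - 2 * Real.pi)
      (B := Set.range θ) (Set.finite_range _) (Set.finite_range _) ⟨_, u, rfl⟩ ⟨_, u, rfl⟩ (by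
        rintro _ ⟨x, rfl⟩ _ ⟨y, rfl⟩
        have := hψr x; have := hψr y; have := hψlt x y
        simp only [θ]
        split_ifs
        · linarith
        · have := this.2 (by omega)
          linarith
        · linarith
        · linarith)
    have hφ : ∀ v, φ < θ v ∧ θ v < φ + 2 * Real.pi := fun v =>
      ⟨h0.trans (h2 _ ⟨v, rfl⟩), by linarith [h1 _ ⟨v, rfl⟩]⟩
    rw [hpθ]
    rcases ht with ht | ht
    · exact exists_segment_frontier hθ hφ (ht.congr hlt)
    · obtain ⟨a, b, hab, h3, h4, h5⟩ := exists_segment_frontier hθ hφ (ht.congr hlt)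
      exact ⟨a, b, hab, by rwa [segment_symm ℝ (circlePt (θ u))], fun h => h4 h.symm,
        fun h => h5 (fun h' => h h'.symm)⟩
  refine ⟨pos, ⟨0, 1, σ, one_ne_zero, fun v => ?_⟩, ⟨fun u v huv => ?_, fun u v huv => ⟨?_, ?_⟩⟩,
    fun u v huv => ?_⟩
  · rw [zero_add, one_mul]
    simp only [hpos, hψ]
    rw [circlePt_eq_exp]
    congr 1
    push_cast
    ring
  · by_contra hne
    obtain ⟨a, b, hab, h1, -⟩ := main u v hne
    rw [huv, segment_same] at h1
    have ha := h1 (left_mem_segment _ _ _)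
    have hb := h1 (right_mem_segment _ _ _)
    simp only [Set.mem_singleton_iff] at ha hb
    exact hab (ha.trans hb.symm)
  · intro hadj
    rw [Set.disjoint_left]
    exact fun z hz hz' => hz'.1 (Or.inr ⟨u, v, hadj, hz⟩)
  · intro hd
    by_contra hadj
    obtain ⟨a, b, -, h1, -, h2⟩ := main u v huv
    exact Set.disjoint_left.1 hd (h1 (left_mem_segment _ _ _)) (h2 hadj (left_mem_segment _ _ _))
  · obtain ⟨a, b, hab, h1, h2, -⟩ := main u v huv.ne
    exact ⟨a, b, hab, h1, h2 huv⟩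

/-! ### Pairs seen from a gap next to one of their ends -/

section NeighborCriteria

variable {V : Type*} {E : V → V → Prop} {f : V → ℤ} {N : ℤ} {u v : V}

/-- A pair is seen if one end has no neighbour in the inner arc of the pair. -/
theorem pairSeen_of_left_inner (hf : Function.Injective f) (hN : ∀ v, 0 ≤ f v ∧ f v < N)
    (hs : ∀ x y, E x y → E y x)
    (huv : f u < f v) (h : ∀ w, E u w → f u < f w → f v ≤ f w) : PairSeen E f N u v := by
  -- The gap right after `u` makes `u` last. Then only edges at `u` can cover the pair, and no chord
  -- cuts off `u`, so the third condition is vacuous. The three lemmas after this one use the other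
  -- gaps next to `u` or `v` in the same way.
  refine ⟨f u + 1, by linarith [(hN u).1], by linarith [(hN u).2], Or.inr ⟨?_, ?_, ?_⟩⟩
  · have := hN v; have := hN u; simp only [rot]; split_ifs <;> omega
  · intro x y hxy h1 h2
    have := hN v; have := hN u; have := hN x; have := hN y
    have hy : f y = f u := by simp only [rot] at h1 h2; split_ifs at h1 h2 <;> omega
    have hy := hf hy
    subst hy
    refine ⟨hf ?_, rfl⟩
    have := h x (hs _ _ hxy)
    simp only [rot] at h1 h2; split_ifs at h1 h2 <;> omega
  · intro x y x' y' hxy hxy' h1 h2 h3 h4 h5 h6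
    have := hN y'; have := hN u
    simp only [rot] at h6; split_ifs at h6 <;> omega

theorem pairSeen_of_left_outer (hf : Function.Injective f) (hN : ∀ v, 0 ≤ f v ∧ f v < N)
    (huv : f u < f v) (h : ∀ w, E u w → f u ≤ f w ∧ f w ≤ f v) : PairSeen E f N u v := by
  refine ⟨f u, by linarith [(hN u).1], by linarith [(hN u).2], Or.inl ⟨?_, ?_, ?_⟩⟩
  · have := hN v; have := hN u; simp only [rot]; split_ifs <;> omega
  · intro x y hxy h1 h2
    have := hN v; have := hN u; have := hN x; have := hN y
    have hx : f x = f u := by simp only [rot] at h1 h2; split_ifs at h1 h2 <;> omega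
    have hx := hf hx
    subst hx
    refine ⟨rfl, hf ?_⟩
    have := h y hxy
    simp only [rot] at h1 h2; split_ifs at h1 h2 <;> omega
  · intro x y x' y' hxy hxy' h1 h2 h3 h4 h5 h6
    have := hN x; have := hN u
    simp only [rot] at h1; split_ifs at h1 <;> omega

theorem pairSeen_of_right_inner (hf : Function.Injective f) (hN : ∀ v, 0 ≤ f v ∧ f v < N)
    (huv : f u < f v) (h : ∀ w, E v w → f u < f w → f v ≤ f w) : PairSeen E f N u v := by
  refine ⟨f v, by linarith [(hN v).1], by linarith [(hN v).2], Or.inr ⟨?_, ?_, ?_⟩⟩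
  · have := hN v; have := hN u; simp only [rot]; split_ifs <;> omega
  · intro x y hxy h1 h2
    have := hN v; have := hN u; have := hN x; have := hN y
    have hx : f x = f v := by simp only [rot] at h1 h2; split_ifs at h1 h2 <;> omega
    have hx := hf hx
    subst hx
    refine ⟨rfl, hf ?_⟩
    have := h y hxy
    simp only [rot] at h1 h2; split_ifs at h1 h2 <;> omega
  · intro x y x' y' hxy hxy' h1 h2 h3 h4 h5 h6
    have := hN x; have := hN v
    simp only [rot] at h1; split_ifs at h1 <;> omega

theorem pairSeen_of_right_outer (hf : Function.Injective f) (hN : ∀ v, 0 ≤ f v ∧ f v < N)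
    (hs : ∀ x y, E x y → E y x)
    (huv : f u < f v) (h : ∀ w, E v w → f u ≤ f w ∧ f w ≤ f v) : PairSeen E f N u v := by
  refine ⟨f v + 1, by linarith [(hN v).1], by linarith [(hN v).2], Or.inl ⟨?_, ?_, ?_⟩⟩
  · have := hN v; have := hN u; simp only [rot]; split_ifs <;> omega
  · intro x y hxy h1 h2
    have := hN v; have := hN u; have := hN x; have := hN y
    have hy : f y = f v := by simp only [rot] at h1 h2; split_ifs at h1 h2 <;> omega
    have hy := hf hy
    subst hy
    refine ⟨hf ?_, rfl⟩
    have := h x (hs _ _ hxy)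
    simp only [rot] at h1 h2; split_ifs at h1 h2 <;> omega
  · intro x y x' y' hxy hxy' h1 h2 h3 h4 h5 h6
    have := hN y'; have := hN v
    simp only [rot] at h6; split_ifs at h6 <;> omega

end NeighborCriteria

/-! ### Assembling good orders -/

theorem hasGoodOrder_bot {V : Type*} [Finite V] : HasGoodOrder (⊥ : SimpleGraph V) := by
  obtain ⟨n, ⟨e⟩⟩ := Finite.exists_equiv_fin V
  refine ⟨fun v => (e v : ℕ), n, fun x y h => e.injective (Fin.ext (by
      simpa using h)),
    fun v => ⟨by positivity, by simp⟩, fun u v huv => ?_⟩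
  refine ⟨0, le_rfl, by positivity, ?_⟩
  have : ((e u : ℕ) : ℤ) ≠ (e v : ℕ) := fun h => huv (e.injective (Fin.ext (by exact_mod_cast h)))
  rcases lt_or_gt_of_ne this with h | h
  · exact Or.inl ⟨by simp [rot]; omega, fun _ _ h => h.elim, fun _ _ _ _ h => h.elim⟩
  · exact Or.inr ⟨by simp [rot]; omega, fun _ _ h => h.elim, fun _ _ _ _ h => h.elim⟩

/-- Gluing: the vertices are partitioned into fibers, each with a root; if the edges run within
fibers or between roots, good orders of the fibers and of the roots combine to a good order. -/
theorem HasGoodOrder.glue {V R : Type*} {G G' : SimpleGraph V} (r : V → R) (s : R → V)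
    (hrs : ∀ c, r (s c) = c)
    (hE : ∀ x y, G.Adj x y → (r x = r y ∧ G'.Adj x y) ∨ (s (r x) = x ∧ s (r y) = y))
    (hG' : HasGoodOrder G') (hR : HasGoodOrder (G.comap s)) : HasGoodOrder G := by
  obtain ⟨f, M, hf, hM, Hf⟩ := hG'
  obtain ⟨h, L, hh, hL, Hh⟩ := hR
  -- The distance of `x` from the root of its fibre, going around the order `f`: the fibre keeps its
  -- cyclic order but starts at its root.
  set g : V → ℤ := fun x => rot M (f (s (r x))) (f x) - f (s (r x)) with hg
  have g0 : ∀ x, 0 ≤ g x ∧ g x < M := by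
    intro x
    have := hM x; have := hM (s (r x))
    simp only [hg, rot]; split_ifs <;> omega
  have ginj : ∀ x y, r x = r y → g x = g y → x = y := by
    intro x y hr hxy
    have := hM x; have := hM y; have := hM (s (r y))
    apply hf
    simp only [hg, rot, hr] at hxy
    split_ifs at hxy <;> omega
  have gs : ∀ c, g (s c) = 0 := fun c => by simp [hg, rot, hrs]
  have groot : ∀ x, s (r x) = x → g x = 0 := fun x hx => by rw [← hx, gs]
  have gpos : ∀ x, s (r x) ≠ x → 0 < g x := by
    intro x hx
    refine (g0 x).1.lt_of_ne fun h0 => hx ?_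
    exact ginj _ _ (by rw [hrs]) (by rw [gs, h0])
  have blk : ∀ a b : ℤ, a < b → a * M + M ≤ b * M ∨ M ≤ 0 := by
    intro a b hab
    by_cases hm : M ≤ 0
    · exact Or.inr hm
    · left; nlinarith
  have blk' : ∀ (_ : V) (a b : ℤ), a < b → a * M + M ≤ b * M := by
    intro x a b hab
    have := g0 x
    rcases blk a b hab with h | h <;> omega
  -- The fibre of `c` occupies the block `[h c * M, h c * M + M)`, with its root at the first
  -- position.
  set F : V → ℤ := fun x => h (r x) * M + g x with hF
  have hFr : ∀ x y, h (r x) < h (r y) → F x < h (r y) * M := by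
    intro x y hxy
    have := blk' x _ _ hxy; have := g0 x
    simp only [hF]; omega
  have hFinj : Function.Injective F := by
    intro x y hxy
    have hr : r x = r y := by
      apply hh
      have := g0 x; have := g0 y
      rcases lt_trichotomy (h (r x)) (h (r y)) with h1 | h1 | h1
      · have := hFr x y h1; simp only [hF] at hxy this; omega
      · exact h1
      · have := hFr y x h1; simp only [hF] at hxy this; omega
    refine ginj x y hr ?_
    simp only [hF, hr] at hxy
    omega
  have hFN : ∀ x, 0 ≤ F x ∧ F x < L * M := by
    intro x
    have h1 := hL (r x); have := g0 x
    have h2 := blk' x _ _ h1.2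
    have : 0 ≤ h (r x) * M := mul_nonneg h1.1 (by omega)
    simp only [hF]; omega
  have hBN : ∀ (_ : V) c, 0 ≤ h c * M ∧ h c * M + M ≤ L * M := by
    intro x c
    have h1 := hL c; have := g0 x
    exact ⟨mul_nonneg h1.1 (by omega), blk' x _ _ h1.2⟩
  have inB : ∀ c x, r x = c → h c * M ≤ F x ∧ F x < h c * M + M := by
    intro c x hc
    have := g0 x
    simp only [hF, hc]; omega
  have outB : ∀ c x, r x ≠ c → F x < h c * M ∨ h c * M + M ≤ F x := by
    intro c x hc
    have := g0 x
    rcases lt_or_gt_of_ne (hh.ne hc) with h1 | h1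
    · have := blk' x _ _ h1; left; simp only [hF]; omega
    · have := blk' x _ _ h1; right; simp only [hF]; omega
  have same : ∀ c x y, r x = r y → r x ≠ c → (F x < h c * M ∧ F y < h c * M) ∨
      (h c * M + M ≤ F x ∧ h c * M + M ≤ F y) := by
    intro c x y hxy hc
    have := g0 x; have := g0 y
    rcases lt_or_gt_of_ne (hh.ne hc) with h1 | h1
    · have := blk' x _ _ h1; left; simp only [hF, ← hxy]; omega
    · have := blk' x _ _ h1; right; simp only [hF, ← hxy]; omega
  have kinds : ∀ x y, s (r x) = x → s (r y) = y → r x ≠ r y → ∀ c,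
      (F x = h c * M ∧ (F y < h c * M ∨ h c * M + M ≤ F y)) ∨
      (F y = h c * M ∧ (F x < h c * M ∨ h c * M + M ≤ F x)) ∨
      ((F x < h c * M ∨ h c * M + M ≤ F x) ∧ (F y < h c * M ∨ h c * M + M ≤ F y)) := by
    intro x y hx hy hne c
    by_cases cx : r x = c
    · refine Or.inl ⟨by simp only [hF, groot x hx, cx, add_zero], outB c y (cx ▸ hne.symm)⟩
    by_cases cy : r y = c
    · exact Or.inr (Or.inl ⟨by simp only [hF, groot y hy, cy, add_zero], outB c x cx⟩)
    · exact Or.inr (Or.inr ⟨outB c x cx, outB c y cy⟩)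
  have case1 : ∀ u v, r u = r v → u ≠ v → PairSeen G.Adj F (L * M) u v := by
    have aux : ∀ u v t, r u = r v → 0 ≤ t → t ≤ M → ∃ T, 0 ≤ T ∧ T ≤ L * M ∧
        h (r u) * M < T ∧ T ≤ h (r u) * M + M ∧
        ∀ x y, r x = r u → r y = r u → (rot M t (f x) < rot M t (f y) ↔
          rot (L * M) T (F x) < rot (L * M) T (F y)) := by
      intro u v t huv ht0 ht1
      have hB := hBN u (r u)
      have h0 := hM (s (r u))
      -- The cut `t` is carried into the block with an offset in `(0, M]`. Offset `0` is replaced by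
      -- `M`: a cut right before the root would let edges from the root to other blocks cover this
      -- block.
      refine ⟨h (r u) * M + if f (s (r u)) < t then t - f (s (r u)) else t + M - f (s (r u)),
        ?_, ?_, ?_, ?_, ?_⟩
      · split_ifs <;> omega
      · split_ifs <;> omega
      · split_ifs <;> omega
      · split_ifs <;> omega
      intro x y hx hy
      have := hM x; have := hM y
      simp only [hF, hg, hx, hy]
      generalize h (r u) * M = B at *
      generalize L * M = N at *
      generalize f (s (r u)) = z at *
      have e1 : rot M z (f x) = f x ∧ z ≤ f x ∨ rot M z (f x) = f x + M ∧ f x < z := by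
        simp only [rot]; split_ifs <;> omega
      have e2 : rot M z (f y) = f y ∧ z ≤ f y ∨ rot M z (f y) = f y + M ∧ f y < z := by
        simp only [rot]; split_ifs <;> omega
      generalize rot M z (f x) = fx at *
      generalize rot M z (f y) = fy at *
      simp only [rot]
      split_ifs <;> omega
    have aux2 : ∀ u v t, r u = r v → 0 ≤ t → t ≤ M → Sees G'.Adj (fun w => rot M t (f w)) u v →
        ∃ T, 0 ≤ T ∧ T ≤ L * M ∧ Sees G.Adj (fun w => rot (L * M) T (F w)) u v := by
      intro u v t huv ht0 ht1 H
      obtain ⟨T, hT0, hT1, hT2, hT3, hcmp⟩ := aux u v t huv ht0 ht1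
      have hcmp' : ∀ x y, r x = r u → r y = r u → (rot M t (f x) ≤ rot M t (f y) ↔
          rot (L * M) T (F x) ≤ rot (L * M) T (F y)) := fun x y hx hy => by
        rw [← not_lt, ← not_lt, hcmp _ _ hy hx]
      refine ⟨T, hT0, hT1, (hcmp _ _ rfl huv.symm).1 H.1, ?_, ?_⟩
      · intro x y hxy h1 h2
        have hB := hBN u (r u)
        have lu := inB (r u) u rfl; have lv := inB (r u) v huv.symm
        have bx := hFN x; have bY := hFN y
        rcases hE x y hxy with ⟨hr, hadj⟩ | ⟨hx, hy⟩
        · by_cases hc : r x = r u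
          · exact H.2.1 x y hadj ((hcmp' _ _ hc rfl).2 h1) ((hcmp' _ _ huv.symm (hr ▸ hc)).2 h2)
          · exfalso
            have h3 := (hcmp _ _ rfl huv.symm).1 H.1
            have := same (r u) x y hr hc
            simp only [rot] at h1 h2 h3
            split_ifs at h1 h2 h3 <;> omega
        · exfalso
          have h3 := (hcmp _ _ rfl huv.symm).1 H.1
          have hne : r x ≠ r y := fun e => hxy.ne (by rw [← hx, ← hy, e])
          have hk := kinds x y hx hy hne (r u)
          simp only [rot] at h1 h2 h3
          rcases hk with hk | hk | hk <;> split_ifs at h1 h2 h3 <;> omega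
      · intro x y x' y' hxy hxy' h1 h2 h3 h4 h5 h6
        have hB := hBN u (r u)
        have lu := inB (r u) u rfl; have lv := inB (r u) v huv.symm
        have huv' := (hcmp _ _ rfl huv.symm).1 H.1
        -- Edges other than `G'`-edges inside this fibre touch the block at most at its root, which
        -- is the first position. So they cannot act as chords cutting off `u` or `v`.
        have bad : ∀ x y w, G.Adj x y → ¬ (r x = r y ∧ G'.Adj x y ∧ r x = r u) → r w = r u →
            rot (L * M) T (F x) < rot (L * M) T (F w) → rot (L * M) T (F w) < rot (L * M) T (F y) →
            (rot (L * M) T (F y) < rot (L * M) T (F v) ∨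
              rot (L * M) T (F u) < rot (L * M) T (F x)) → False := by
          intro x y w hxy hnf hw h1 h2 h3
          have lw := inB (r u) w hw
          have bx := hFN x; have bY := hFN y
          rcases hE x y hxy with ⟨hr, hadj⟩ | ⟨hx, hy⟩
          · have := same (r u) x y hr fun e => hnf ⟨hr, hadj, e⟩
            clear h3 huv'
            simp only [rot] at h1 h2
            split_ifs at h1 h2 <;> omega
          · have hne : r x ≠ r y := fun e => hxy.ne (by rw [← hx, ← hy, e])
            have hk := kinds x y hx hy hne (r u)
            simp only [rot] at h1 h2 h3 huv'
            rcases hk with hk | hk | hk <;> rcases h3 with h3 | h3 <;>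
              split_ifs at h1 h2 h3 huv' <;> omega
        have k1 : r x = r y ∧ G'.Adj x y ∧ r x = r u := by
          by_contra hc
          exact bad x y u hxy hc rfl h1 h2 (Or.inl h3)
        have k2 : r x' = r y' ∧ G'.Adj x' y' ∧ r x' = r u := by
          by_contra hc
          exact bad x' y' v hxy' hc huv.symm h5 h6 (Or.inr h4)
        have ky : r y = r u := k1.1 ▸ k1.2.2
        have ky' : r y' = r u := k2.1 ▸ k2.2.2
        exact (hcmp' _ _ ky k2.2.2).1 (H.2.2 x y x' y' k1.2.1 k2.2.1
          ((hcmp _ _ k1.2.2 rfl).2 h1) ((hcmp _ _ rfl ky).2 h2) ((hcmp _ _ ky huv.symm).2 h3)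
          ((hcmp _ _ rfl k2.2.2).2 h4) ((hcmp _ _ k2.2.2 huv.symm).2 h5)
          ((hcmp _ _ huv.symm ky').2 h6))
    intro u v hr huv
    obtain ⟨t, h0, h1, ht | ht⟩ := Hf u v huv
    · obtain ⟨T, H0, H1, H⟩ := aux2 u v t hr h0 h1 ht
      exact ⟨T, H0, H1, Or.inl H⟩
    · obtain ⟨T, H0, H1, H⟩ := aux2 v u t hr.symm h0 h1 ht
      exact ⟨T, H0, H1, Or.inr H⟩
  have case2 : ∀ u v, r u ≠ r v → s (r u) ≠ u → PairSeen G.Adj F (L * M) v u := by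
    intro u v hr hu
    have hB := hBN u (r u)
    have lu := inB (r u) u rfl; have lv := outB (r u) v hr.symm
    have gu := gpos u hu
    have hFu : h (r u) * M < F u := by simp only [hF]; omega
    have bu := hFN u; have bv := hFN v
    have hor : ∀ x, h (r u) * M < F x → F x < h (r u) * M + M → r x = r u ∧ s (r x) ≠ x := by
      intro x h1 h2
      have hx : r x = r u := by
        by_contra h3
        have := outB (r u) x h3
        omega
      refine ⟨hx, fun e => ?_⟩
      have := groot x e
      simp only [hF, hx] at h1; omega
    -- The cut after the block of `u` puts this block last. Edges ending beyond a non-root vertex of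
    -- the block stay inside it, while a chord coming from before `v` reaches at most its root.
    refine ⟨h (r u) * M + M, by omega, hB.2, Or.inl ⟨?_, ?_, ?_⟩⟩
    · simp only [rot]; split_ifs <;> omega
    · intro x y hxy h1 h2
      exfalso
      have bx := hFN x; have bY := hFN y
      have hy := hor y (by simp only [rot] at h2; split_ifs at h2 <;> omega)
        (by simp only [rot] at h2; split_ifs at h2 <;> omega)
      rcases hE x y hxy with ⟨hr', -⟩ | ⟨-, hy'⟩
      · have lx := inB (r u) x (hr'.trans hy.1)
        simp only [rot] at h1; split_ifs at h1 <;> omega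
      · exact hy.2 hy'
    · intro x y x' y' hxy hxy' h1 h2 h3 h4 h5 h6
      have bx := hFN x; have bY := hFN y; have bx' := hFN x'; have bY' := hFN y'
      have hy := hor y' (by simp only [rot] at h6; split_ifs at h6 <;> omega)
        (by simp only [rot] at h6; split_ifs at h6 <;> omega)
      have hx' : r x' = r u := by
        rcases hE x' y' hxy' with ⟨hr', -⟩ | ⟨-, hy'⟩
        · exact hr'.trans hy.1
        · exact (hy.2 hy').elim
      have lx' := inB (r u) x' hx'
      by_cases hc : r y = r u
      · rcases hE x y hxy with ⟨hr', -⟩ | ⟨-, hy'⟩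
        · exfalso
          have lx := inB (r u) x (hr'.trans hc)
          simp only [rot] at h1; split_ifs at h1 <;> omega
        · have gy := groot y hy'
          have : F y = h (r u) * M := by simp only [hF, gy, hc, add_zero]
          simp only [rot]; split_ifs <;> omega
      · have ly := outB (r u) y hc
        simp only [rot]; split_ifs <;> omega
  have case3 : ∀ c d, c ≠ d → PairSeen G.Adj F (L * M) (s c) (s d) := by
    have aux : ∀ c d t, 0 ≤ t → t ≤ L → Sees (G.comap s).Adj (fun w => rot L t (h w)) c d →
        Sees G.Adj (fun w => rot (L * M) (t * M) (F w)) (s c) (s d) := by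
      intro c d t ht0 ht1 H
      have hk : ∀ x, rot (L * M) (t * M) (F x) = rot L t (h (r x)) * M + g x := by
        intro x
        have gx := g0 x
        simp only [rot]
        by_cases hx : h (r x) < t
        · have := blk' x _ _ hx
          rw [if_pos hx, if_pos (by simp only [hF]; omega)]
          simp only [hF]; ring
        · have : t * M ≤ h (r x) * M := mul_le_mul_of_nonneg_right (not_lt.1 hx) (by omega)
          rw [if_neg hx, if_neg (by simp only [hF]; omega)]
      set k : R → ℤ := fun c => rot L t (h c) with hkdef
      have kinj : Function.Injective k := by
        intro a b hab
        have := hL a; have := hL b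
        apply hh
        simp only [hkdef, rot] at hab
        split_ifs at hab <;> omega
      have kb := blk' (s c)
      have kc : rot (L * M) (t * M) (F (s c)) = k c * M := by rw [hk, gs, hrs, add_zero]
      have kd : rot (L * M) (t * M) (F (s d)) = k d * M := by rw [hk, gs, hrs, add_zero]
      have kx : ∀ x, s (r x) = x → rot (L * M) (t * M) (F x) = k (r x) * M := fun x hx => by
        rw [hk, groot x hx, add_zero]
      have km : ∀ a b, a * M < b * M ↔ a < b := fun a b => by
        have := g0 (s c)
        exact mul_lt_mul_iff_left₀ (by omega)
      have km' : ∀ a b, a * M ≤ b * M ↔ a ≤ b := fun a b => by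
        rw [← not_lt, km, not_lt]
      -- Roots come first in their blocks and the cut `t * M` lies between blocks, so an edge within
      -- a fibre never passes over a root. Only edges between roots can hide a pair of roots.
      have fib : ∀ x y e, r x = r y → rot (L * M) (t * M) (F x) < k e * M →
          k e * M ≤ rot (L * M) (t * M) (F y) → False := by
        intro x y e hxy h1 h2
        rw [hk] at h1 h2
        have := g0 x; have := g0 y
        rw [← hxy] at h2
        have : k (r x) < k e ∨ k e ≤ k (r x) := lt_or_ge _ _
        rcases this with h3 | h3
        · have := kb _ _ h3
          simp only [hkdef] at *
          omega
        · have := (km' _ _).2 h3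
          simp only [hkdef] at *
          omega
      simp only [Sees, kc, kd]
      refine ⟨(km _ _).2 H.1, ?_, ?_⟩
      · intro x y hxy h1 h2
        rcases hE x y hxy with ⟨hr, -⟩ | ⟨hx, hy⟩
        · exact (fib x y d hr (h1.trans_lt ((km _ _).2 H.1)) h2).elim
        · rw [kx x hx, km'] at h1
          rw [kx y hy, km'] at h2
          have := H.2.1 (r x) (r y) (by rw [comap_adj, hx, hy]; exact hxy) h1 h2
          rw [← this.1, ← this.2, hx, hy]
          exact ⟨rfl, rfl⟩
      · intro x y x' y' hxy hxy' h1 h2 h3 h4 h5 h6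
        rcases hE x y hxy with ⟨hr, -⟩ | ⟨hx, hy⟩
        · exact (fib x y c hr h1 h2.le).elim
        rcases hE x' y' hxy' with ⟨hr, -⟩ | ⟨hx', hy'⟩
        · exact (fib x' y' d hr h5 h6.le).elim
        rw [kx x hx, km] at h1
        rw [kx y hy, km] at h2 h3
        rw [kx x' hx', km] at h4 h5
        rw [kx y' hy', km] at h6
        rw [kx y hy, kx x' hx', km']
        exact H.2.2 (r x) (r y) (r x') (r y') (by rw [comap_adj, hx, hy]; exact hxy)
          (by rw [comap_adj, hx', hy']; exact hxy') h1 h2 h3 h4 h5 h6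
    intro c d hcd
    obtain ⟨t, h0, h1, ht⟩ := Hh c d hcd
    have := g0 (s c)
    exact ⟨t * M, mul_nonneg h0 (by omega), mul_le_mul_of_nonneg_right h1 (by omega),
      ht.imp (aux c d t h0 h1) (aux d c t h0 h1)⟩
  refine ⟨F, L * M, hFinj, hFN, fun u v huv => ?_⟩
  by_cases hr : r u = r v
  · exact case1 u v hr huv
  by_cases hu : s (r u) = u
  · by_cases hv : s (r v) = v
    · rw [← hu, ← hv]
      exact case3 _ _ hr
    · exact case2 v u (Ne.symm hr) hv
  · exact (case2 u v hr hu).symm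

theorem hasGoodOrder_bool (G : SimpleGraph Bool) : HasGoodOrder G := by
  refine ⟨fun b => if b then 1 else 0, 2, by intro a b; cases a <;> cases b <;> simp,
    by intro b; cases b <;> simp, fun u v huv => ⟨0, by simp, by simp, ?_⟩⟩
  cases u <;> cases v <;> first | exact (huv rfl).elim | skip
  · refine Or.inl ⟨by simp [rot], ?_, ?_⟩
    · intro x y hxy; cases x <;> cases y <;> simp [rot] at hxy ⊢
    · intro x y; cases x <;> cases y <;> simp [rot]
  · refine Or.inr ⟨by simp [rot], ?_, ?_⟩
    · intro x y hxy; cases x <;> cases y <;> simp [rot] at hxy ⊢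
    · intro x y; cases x <;> cases y <;> simp [rot]

/-- Adding back an edge that is the only edge across a cut. -/
theorem HasGoodOrder.of_cut_edge {V : Type*} {G G' : SimpleGraph V} (K : Set V)
    {x y : V} (hx : x ∉ K) (hy : y ∈ K)
    (hG' : ∀ a b, G.Adj a b → s(a, b) ≠ s(x, y) → G'.Adj a b)
    (hK : ∀ a b, G.Adj a b → a ∈ K → b ∉ K → a = y ∧ b = x)
    (H : HasGoodOrder G') : HasGoodOrder G := by
  classical
  refine HasGoodOrder.glue (R := Bool) (fun v => decide (v ∈ K)) (fun b => if b then y else x)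
    (by intro c; cases c <;> simp [hx, hy]) ?_ H (hasGoodOrder_bool _)
  intro a b hab
  by_cases ha : a ∈ K <;> by_cases hb : b ∈ K
  · refine Or.inl ⟨by simp [ha, hb], hG' a b hab ?_⟩
    intro e
    rcases Sym2.eq_iff.1 e with ⟨rfl, rfl⟩ | ⟨rfl, rfl⟩ <;> contradiction
  · obtain ⟨rfl, rfl⟩ := hK a b hab ha hb
    simp [ha, hb]
  · obtain ⟨rfl, rfl⟩ := hK b a hab.symm hb ha
    simp [ha, hb]
  · refine Or.inl ⟨by simp [ha, hb], hG' a b hab ?_⟩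
    intro e
    rcases Sym2.eq_iff.1 e with ⟨rfl, rfl⟩ | ⟨rfl, rfl⟩ <;> contradiction

theorem HasGoodOrder.of_injective {V W : Type*} {G : SimpleGraph V} {H : SimpleGraph W}
    (φ : V → W) (hφ : Function.Injective φ) (h : ∀ x y, G.Adj x y → H.Adj (φ x) (φ y))
    (hH : HasGoodOrder H) : HasGoodOrder G := by
  obtain ⟨f, N, hf, hN, hs⟩ := hH
  have aux : ∀ t u v, Sees H.Adj (fun w => rot N t (f w)) (φ u) (φ v) →
      Sees G.Adj (fun w => rot N t (f (φ w))) u v := by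
    intro t u v ⟨h1, h2, h3⟩
    refine ⟨h1, fun x y hxy hx hy => ?_, fun x y x' y' hxy hxy' =>
      h3 _ _ _ _ (h _ _ hxy) (h _ _ hxy')⟩
    have := h2 _ _ (h _ _ hxy) hx hy
    exact ⟨hφ this.1, hφ this.2⟩
  refine ⟨f ∘ φ, N, hf.comp hφ, fun v => hN _, fun u v huv => ?_⟩
  obtain ⟨t, h0, h1, ht⟩ := hs _ _ (hφ.ne huv)
  exact ⟨t, h0, h1, ht.imp (aux t u v) (aux t v u)⟩

/-! ### Grids -/

/-- The diagonals of a grid are placed alternately on an upper and a lower row. -/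
theorem hasGoodOrder_of_diagonals {V : Type*} {G : SimpleGraph V} (d i : V → ℤ) (k l : ℤ)
    (hinj : ∀ x y, d x = d y → i x = i y → x = y)
    (hi : ∀ x, 0 ≤ i x ∧ i x < k) (hd : ∀ x, 0 ≤ d x ∧ d x < l)
    (hG : ∀ x y, G.Adj x y → (d y = d x + 1 ∧ (i y = i x ∨ i y = i x + 1)) ∨
      (d x = d y + 1 ∧ (i x = i y ∨ i x = i y + 1))) : HasGoodOrder G := by
  set f : V → ℤ := fun x => if d x % 2 = 0 then d x * k + i x else 2 * (l * k) - d x * k - k + i x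
    with hf
  have h1 : ∀ x y, d x < d y → d x * k + k ≤ d y * k := fun x y h => by
    have := hi x; nlinarith
  have h3 : ∀ x y, d x + 3 ≤ d y → d x * k + 3 * k ≤ d y * k := fun x y h => by
    have := hi x; nlinarith
  have h1' : ∀ x y, d y = d x + 1 → d y * k = d x * k + k := fun x y h => by rw [h]; ring
  have hD : ∀ x, 0 ≤ d x * k ∧ d x * k + k ≤ l * k := fun x => by
    have := hi x; have := hd x
    constructor <;> nlinarith
  have he : ∀ x, d x % 2 = 0 → f x = d x * k + i x ∧ f x < l * k := fun x h => by
    have := hD x; have := hi x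
    have h' : f x = d x * k + i x := if_pos h
    exact ⟨h', by omega⟩
  have ho : ∀ x, d x % 2 ≠ 0 → f x = 2 * (l * k) - d x * k - k + i x ∧ l * k ≤ f x := fun x h => by
    have := hD x; have := hi x
    have h' : f x = 2 * (l * k) - d x * k - k + i x := if_neg h
    exact ⟨h', by omega⟩
  have hN : ∀ x, 0 ≤ f x ∧ f x < 2 * (l * k) := fun x => by
    have := hD x; have := hi x
    by_cases h : d x % 2 = 0
    · have := he x h; omega
    · have := ho x h; omega
  have hfi : Function.Injective f := by
    intro x y hxy
    have := hi x; have := hi y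
    have hdd : d x = d y := by
      have := h1 x y; have := h1 y x
      by_cases hx : d x % 2 = 0 <;> by_cases hy : d y % 2 = 0
      · have := he x hx; have := he y hy; omega
      · have := he x hx; have := ho y hy; omega
      · have := ho x hx; have := he y hy; omega
      · have := ho x hx; have := ho y hy; omega
    refine hinj x y hdd ?_
    by_cases hx : d x % 2 = 0
    · have := he x hx; have := he y (hdd ▸ hx); rw [hdd] at *; omega
    · have := ho x hx; have := ho y (hdd ▸ hx); rw [hdd] at *; omega
  have nb : ∀ x y, G.Adj x y → (d x % 2 = 0 ∧ d y % 2 ≠ 0) ∨ (d x % 2 ≠ 0 ∧ d y % 2 = 0) := by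
    intro x y h; have := hG x y h; omega
  have hs : ∀ x y, G.Adj x y → G.Adj y x := fun _ _ h => h.symm
  have main : ∀ u v, f u < f v → PairSeen G.Adj f (2 * (l * k)) u v := by
    intro u v huv
    by_cases hu : d u % 2 = 0 <;> by_cases hv : d v % 2 = 0
    -- Two vertices in the same row: all neighbours of `u` lie in the other row.
    · refine pairSeen_of_left_inner hfi hN hs huv fun w hw _ => ?_
      have := nb u w hw
      have := ho w (by omega); have := he v hv; omega
    · have eu := he u hu; have ev := ho v hv
      have iu := hi u; have iv := hi v
      by_cases c1 : d u + 3 ≤ d v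
      -- The odd row runs backwards through the diagonals, so the neighbours of `u` all come after
      -- the more distant diagonal of `v`.
      · refine pairSeen_of_left_inner hfi hN hs huv fun w hw _ => ?_
        have := nb u w hw
        have := ho w (by omega); have := hi w; have := h1 w v; have := hG u w hw; omega
      by_cases c2 : d v + 3 ≤ d u
      · refine pairSeen_of_left_outer hfi hN huv fun w hw => ?_
        have := nb u w hw
        have := ho w (by omega); have := hi w; have := h1 v w; have := hG u w hw; omega
      have e1 := h1' u v; have e2 := h1' v u
      by_cases c3 : d v = d u + 1
      -- On consecutive diagonals the neighbours have two consecutive indices. Comparing `i u` with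
      -- `i v` tells which end has no neighbour in the way.
      · by_cases c4 : i v ≤ i u
        · refine pairSeen_of_left_inner hfi hN hs huv fun w hw _ => ?_
          have := nb u w hw
          have := ho w (by omega); have := hi w; have := h1' u w; have := h1' w u
          have := hG u w hw; omega
        · refine pairSeen_of_right_outer hfi hN hs huv fun w hw => ?_
          have := nb v w hw
          have := he w (by omega); have := hi w; have := h1' v w; have := h1' w v
          have := hG v w hw; omega
      · by_cases c4 : i u ≤ i v
        · refine pairSeen_of_left_outer hfi hN huv fun w hw => ?_
          have := nb u w hw
          have := ho w (by omega); have := hi w; have := h1' u w; have := h1' w u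
          have := hG u w hw; omega
        · refine pairSeen_of_right_inner hfi hN huv fun w hw _ => ?_
          have := nb v w hw
          have := he w (by omega); have := hi w; have := h1' v w; have := h1' w v
          have := hG v w hw; omega
    · have := ho u hu; have := he v hv; omega
    · refine pairSeen_of_left_inner hfi hN hs huv fun w hw _ => ?_
      have := nb u w hw
      have := he w (by omega); have := ho u hu; omega
  refine ⟨f, _, hfi, hN, fun u v huv => ?_⟩
  rcases lt_or_gt_of_ne (hfi.ne huv) with h | h
  · exact main u v h
  · exact (main v u h).symm

theorem IsGrid.hasGoodOrder {V : Type*} {G : SimpleGraph V} (h : IsGrid G) : HasGoodOrder G := by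
  obtain ⟨k, l, hk, hl, ⟨e⟩⟩ := h
  refine HasGoodOrder.of_injective (H := pathGraph k □ pathGraph l) e e.injective
    (fun x y hxy => e.map_adj_iff.2 hxy) ?_
  -- Each grid edge raises the sum of the coordinates by one, and the first coordinate by zero or
  -- one.
  refine hasGoodOrder_of_diagonals (fun x => ((x.1 : ℕ) : ℤ) + (x.2 : ℕ)) (fun x => (x.1 : ℕ))
    k (k + l) ?_ ?_ ?_ ?_
  · intro x y h1 h2
    have := Fin.ext_iff (a := x.1) (b := y.1); have := Fin.ext_iff (a := x.2) (b := y.2)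
    exact Prod.ext (by omega) (by omega)
  · intro x; have := x.1.2; omega
  · intro x; have := x.1.2; have := x.2.2; omega
  · intro x y hxy
    rw [boxProd_adj, pathGraph_adj, pathGraph_adj] at hxy
    have := Fin.ext_iff (a := x.1) (b := y.1); have := Fin.ext_iff (a := x.2) (b := y.2)
    omega

/-! ### Cacti -/

/-- Cycles have good orders: their vertices are placed alternately on two rows. -/
theorem hasGoodOrder_of_cyclic {k : ℕ} {G : SimpleGraph (Fin k)}
    (hG : ∀ i j, G.Adj i j → (i : ℕ) + 1 = j ∨ (j : ℕ) + 1 = i ∨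
      ((i : ℕ) = 0 ∧ (j : ℕ) + 1 = k) ∨ ((j : ℕ) = 0 ∧ (i : ℕ) + 1 = k)) : HasGoodOrder G := by
  set f : Fin k → ℤ := fun i => if (i : ℕ) % 2 = 1 then ((i : ℕ) : ℤ) else 2 * k - (i : ℕ) with hf
  have he : ∀ x : Fin k, (x : ℕ) % 2 = 1 ∧ f x = (x : ℕ) ∨
      (x : ℕ) % 2 = 0 ∧ f x = 2 * k - (x : ℕ) := fun x => by
    by_cases h : (x : ℕ) % 2 = 1
    · exact Or.inl ⟨h, if_pos h⟩
    · exact Or.inr ⟨by omega, if_neg h⟩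
  have hN : ∀ x, 0 ≤ f x ∧ f x < 2 * k + 1 := fun x => by
    have := he x; have := x.2; omega
  have hfi : Function.Injective f := by
    intro x y hxy
    have := he x; have := he y; have := x.2; have := y.2
    exact Fin.ext (by omega)
  have hs : ∀ x y, G.Adj x y → G.Adj y x := fun _ _ h => h.symm
  have main : ∀ u v, f u < f v → PairSeen G.Adj f (2 * k + 1) u v := by
    intro u v huv
    have eu := he u; have ev := he v; have bu := u.2; have bv := v.2
    -- Vertex `0` is separate because its second neighbour `k - 1`, along the closing edge, can lie
    -- between `u` and `0`.
    by_cases c0 : (u : ℕ) % 2 = 1 ∧ (v : ℕ) = 0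
    · refine pairSeen_of_left_outer hfi hN huv fun w hw => ?_
      have := he w; have := hG u w hw; have := w.2; omega
    by_cases c1 : (u : ℕ) % 2 = 1 ∧ (v : ℕ) % 2 = 0 ∧ (v : ℕ) < u
    · refine pairSeen_of_right_inner hfi hN huv fun w hw _ => ?_
      have := he w; have := hG v w hw; have := w.2; omega
    · refine pairSeen_of_left_inner hfi hN hs huv fun w hw _ => ?_
      have := he w; have := hG u w hw; have := w.2; omega
  refine ⟨f, _, hfi, hN, fun u v huv => ?_⟩
  rcases lt_or_gt_of_ne (hfi.ne huv) with h | h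
  · exact main u v h
  · exact (main v u h).symm

/-- If every two cycles with a common edge have the same edges, then distinct vertices of a cycle
are separated by the removal of its edges. -/
theorem eq_of_reachable_deleteEdges_cycle {V : Type*} {G : SimpleGraph V}
    (hG : ∀ (e : Sym2 V) (u v : V) (p : G.Walk u u) (q : G.Walk v v),
      p.IsCycle → q.IsCycle → e ∈ p.edges → e ∈ q.edges → ∀ e' ∈ p.edges, e' ∈ q.edges)
    {c a b : V} {C : G.Walk c c} (hC : C.IsCycle) (ha : a ∈ C.support) (hb : b ∈ C.support)
    (hab : (G.deleteEdges {e | e ∈ C.edges}).Reachable a b) : a = b := by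
  classical
  by_contra hne
  have hrot := hC.rotate ha
  have hre : ∀ e, e ∈ (C.rotate a ha).edges ↔ e ∈ C.edges :=
    fun e => (C.rotate_edges a ha).mem_iff
  have hrs : b ∈ (C.rotate a ha).support := (Walk.mem_support_rotate_iff C a ha).2 hb
  generalize C.rotate a ha = D at *
  cases D with
  | nil => exact hrot.ne_nil rfl
  | @cons _ c1 _ h q =>
    obtain ⟨hq, hnot⟩ := (Walk.cons_isCycle_iff _ _).1 hrot
    have hbq : b ∈ q.support := by
      rcases List.mem_cons.1 (by simpa using hrs) with h | h
      · exact (hne h.symm).elim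
      · exact h
    have hqn : ¬ q.Nil := fun hn => h.ne (Walk.Nil.eq hn).symm
    -- The first edge `s(a, c1)` and the last edge `e'` of the rotated cycle both end at `a`. A
    -- cycle through the first that avoids the last will contradict `hG`.
    set e' : Sym2 V := s(q.penultimate, a) with he'
    have he'q : e' ∈ q.edges := Walk.mk_penultimate_end_mem_edges hqn
    have he'C : e' ∈ C.edges := (hre _).1 (by simp [he'q])
    have heC : s(a, c1) ∈ C.edges := (hre _).1 (by simp)
    have hee : s(a, c1) ≠ e' := fun e => hnot (e ▸ he'q)
    set G2 := G.deleteEdges {e'} with hG2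
    have hreach : (G2.deleteEdges {s(a, c1)}).Reachable a c1 := by
      have h1 : (G2.deleteEdges {s(a, c1)}).Reachable a b := by
        refine hab.mono ?_
        rw [hG2, deleteEdges_deleteEdges]
        refine deleteEdges_anti ?_
        rintro e (rfl | rfl)
        · exact he'C
        · exact heC
      have hna := Walk.endpoint_notMem_support_takeUntil hq hbq hne
      -- The part of the cycle from `c1` to `b` misses `a`, hence both edges. With the connection of
      -- `a` and `b` outside the cycle it closes a cycle through `s(a, c1)`.
      have h2 : (G2.deleteEdges {s(a, c1)}).Reachable c1 b := by
        refine ⟨(q.takeUntil b hbq).transfer _ fun e he => ?_⟩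
        have hea : a ∉ e := fun h => hna (Walk.mem_support_of_mem_edges he h)
        rw [hG2, edgeSet_deleteEdges, edgeSet_deleteEdges]
        refine ⟨⟨Walk.edges_subset_edgeSet _ he, ?_⟩, ?_⟩
        · rintro rfl; exact hea (by simp [he'])
        · rintro rfl; exact hea (by simp)
      exact h1.trans h2.symm
    have hadj : G2.Adj a c1 := by
      rw [hG2, deleteEdges_adj]
      exact ⟨h, by simpa using hee⟩
    obtain ⟨u, D, hD, hDe⟩ := adj_and_reachable_delete_edges_iff_exists_cycle.1 ⟨hadj, hreach⟩
    have hle : G2 ≤ G := deleteEdges_le _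
    have := hG _ _ _ C (D.mapLe hle) hC ((Walk.isCycle_mapLe hle).2 hD) heC (by simpa using hDe)
      e' he'C
    rw [Walk.edges_mapLe_eq_edges] at this
    have h3 := D.edges_subset_edgeSet this
    rw [hG2, edgeSet_deleteEdges] at h3
    exact h3.2 rfl

/-- Connectedness is dropped so that the property survives deleting edges and induction on their
number works: remove a bridge, or else all edges of a cycle, and glue them back. -/
theorem hasGoodOrder_of_cycles {V : Type*} [Fintype V] (G : SimpleGraph V)
    (hG : ∀ (e : Sym2 V) (u v : V) (p : G.Walk u u) (q : G.Walk v v),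
      p.IsCycle → q.IsCycle → e ∈ p.edges → e ∈ q.edges → ∀ e' ∈ p.edges, e' ∈ q.edges) :
    HasGoodOrder G := by
  classical
  induction hn : G.edgeSet.ncard using Nat.strong_induction_on generalizing G with
  | _ n ih =>
  have del : ∀ S : Set (Sym2 V), (∃ e ∈ S, e ∈ G.edgeSet) → HasGoodOrder (G.deleteEdges S) := by
    rintro S ⟨e, heS, heG⟩
    have hle : G.deleteEdges S ≤ G := deleteEdges_le _
    refine ih _ ?_ _ ?_ rfl
    · rw [← hn]
      refine Set.ncard_lt_ncard ⟨edgeSet_mono hle, fun h => ?_⟩ (Set.toFinite _)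
      have := h heG
      rw [edgeSet_deleteEdges] at this
      exact this.2 heS
    · intro e u v p q hp hq he he' e' h
      have := hG e u v (p.mapLe hle) (q.mapLe hle) ((Walk.isCycle_mapLe hle).2 hp)
        ((Walk.isCycle_mapLe hle).2 hq) (by simpa using he) (by simpa using he') e'
        (by simpa using h)
      simpa using this
  by_cases h0 : G = ⊥
  · rw [h0]; exact hasGoodOrder_bot
  obtain ⟨x, y, hxy⟩ := ne_bot_iff_exists_adj.1 h0
  by_cases hbr : G.IsBridge s(x, y)
  · have hG' := del {s(x, y)} ⟨_, rfl, hxy⟩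
    rw [isBridge_iff] at hbr
    set G' := G.deleteEdges {s(x, y)} with hG'def
    have hadj : ∀ a b, G.Adj a b → s(a, b) ≠ s(x, y) → G'.Adj a b := fun a b hab hne => by
      rw [hG'def, deleteEdges_adj]; exact ⟨hab, hne⟩
    refine HasGoodOrder.of_cut_edge {v | G'.Reachable y v} (x := x) (y := y)
      (fun h => hbr (Reachable.symm h)) (Reachable.refl _) hadj ?_ hG'
    intro a b hab ha hb
    by_cases hne : s(a, b) = s(x, y)
    · rcases Sym2.eq_iff.1 hne with ⟨rfl, rfl⟩ | ⟨rfl, rfl⟩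
      · exact (hbr (Reachable.symm ha)).elim
      · exact ⟨rfl, rfl⟩
    · exact (hb (Reachable.trans ha (hadj a b hab hne).reachable)).elim
  rw [isBridge_iff_forall_cycle_notMem hxy] at hbr
  push Not at hbr
  obtain ⟨c, C, hC, hxyC⟩ := hbr
  have hG' := del {e | e ∈ C.edges} ⟨_, hxyC, hxy⟩
  have hsep : ∀ a b, a ∈ C.support → b ∈ C.support →
      (G.deleteEdges {e | e ∈ C.edges}).Reachable a b → a = b :=
    fun a b ha hb => eq_of_reachable_deleteEdges_cycle hG hC ha hb
  set G' := G.deleteEdges {e | e ∈ C.edges} with hG'def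
  have hadj : ∀ a b, G.Adj a b → s(a, b) ∉ C.edges → G'.Adj a b := fun a b hab hne => by
    rw [hG'def, deleteEdges_adj]; exact ⟨hab, hne⟩
  have hlen : 3 ≤ C.length := hC.three_le_length
  set k := C.length with hk
  let s : Fin k → V := fun i => C.getVert i
  have hsC : ∀ i, s i ∈ C.support := fun i => C.getVert_mem_support i
  have hsinj : Function.Injective s := by
    intro i j hij
    exact Fin.ext (hC.getVert_injOn' (by simp; omega) (by simp; omega) hij)
  have hsurj : ∀ v ∈ C.support, ∃ i, s i = v := by
    intro v hv
    obtain ⟨m, hm, hm'⟩ := Walk.mem_support_iff_exists_getVert.1 hv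
    rcases hm'.lt_or_eq with h | h
    · exact ⟨⟨m, h⟩, hm⟩
    · refine ⟨⟨0, by omega⟩, ?_⟩
      simp only [s]
      rw [← hm, h, Walk.getVert_length, Walk.getVert_zero]
  -- The choice depends only on the predicate, so vertices of one component of `G'` get the same
  -- root. Components missing the cycle default to index `0`, which is harmless since no edge leaves
  -- them.
  let ρ : (Fin k → Prop) → Fin k := fun P => if h : ∃ i, P i then h.choose else ⟨0, by omega⟩
  have hρ : ∀ (P : Fin k → Prop) i, P i → P (ρ P) := fun P i hi => by
    have h : ∃ i, P i := ⟨i, hi⟩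
    simp only [ρ, dif_pos h]
    exact h.choose_spec
  let r : V → Fin k := fun v => ρ fun i => G'.Reachable (s i) v
  have hrs : ∀ i, r (s i) = i := by
    intro i
    have := hρ (fun j => G'.Reachable (s j) (s i)) i (Reachable.refl _)
    exact hsinj (hsep _ _ (hsC _) (hsC _) this)
  refine HasGoodOrder.glue r s hrs ?_ hG' ?_
  · intro a b hab
    by_cases he : s(a, b) ∈ C.edges
    · right
      obtain ⟨i, rfl⟩ := hsurj a (C.fst_mem_support_of_mem_edges he)
      obtain ⟨j, rfl⟩ := hsurj b (C.snd_mem_support_of_mem_edges he)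
      rw [hrs, hrs]
      exact ⟨rfl, rfl⟩
    · left
      have h := hadj a b hab he
      refine ⟨?_, h⟩
      have : (fun i => G'.Reachable (s i) a) = fun i => G'.Reachable (s i) b := by
        funext i
        exact propext ⟨fun h' => h'.trans h.reachable, fun h' => h'.trans h.symm.reachable⟩
      simp only [r, this]
  · refine hasGoodOrder_of_cyclic fun i j hij => ?_
    have hij' : G.Adj (s i) (s j) := hij
    -- The cycle has no chord: a chord would survive in `G'` and connect two of its vertices there.
    have he : s(s i, s j) ∈ C.edges := by
      by_contra he
      exact hij'.ne (hsep _ _ (hsC i) (hsC j) (hadj _ _ hij' he).reachable)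
    have hidx : ∀ m, m ≤ k → ∀ i : Fin k, C.getVert m = s i → (m = i ∨ (m = k ∧ (i : ℕ) = 0)) := by
      intro m hm i hmi
      rcases hm.lt_or_eq with h | h
      · left
        exact congrArg Fin.val (hsinj (a₁ := ⟨m, h⟩) (a₂ := i) hmi)
      · right
        refine ⟨h, ?_⟩
        rw [h, hk, Walk.getVert_length] at hmi
        have h0 : s ⟨0, by omega⟩ = s i := by rw [← hmi]; exact C.getVert_zero
        exact (congrArg Fin.val (hsinj h0)).symm
    obtain ⟨m, hm, hme⟩ := (Walk.mk_mem_edges_iff_exists C).1 he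
    rcases Sym2.eq_iff.1 hme with ⟨h1, h2⟩ | ⟨h1, h2⟩
    · have := hidx m hm.le i h1; have := hidx (m + 1) hm j h2; omega
    · have := hidx m hm.le j h1; have := hidx (m + 1) hm i h2; omega

theorem IsCactus.hasGoodOrder {V : Type*} [Fintype V] {G : SimpleGraph V} (h : IsCactus G) :
    HasGoodOrder G := by
  refine hasGoodOrder_of_cycles G fun e u v p q hp hq he he' e' h' => ?_
  rw [← Walk.mem_edges_toSubgraph] at h' ⊢
  rwa [← h.2 e u v p q hp hq he he']

/-! ### Strips -/

theorem Sees.reverse {V : Type*} {E : V → V → Prop} {g h : V → ℤ} {u v : V} (c : ℤ)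
    (hE : ∀ x y, E x y → E y x) (hg : ∀ x, h x = c - g x) (H : Sees E g u v) : Sees E h v u := by
  obtain ⟨h1, h2, h3⟩ := H
  refine ⟨by rw [hg, hg]; omega, fun x y hxy hx hy => ?_, fun x y x' y' hxy hxy' => ?_⟩
  · rw [hg, hg] at hx hy
    exact (h2 y x (hE _ _ hxy) (by omega) (by omega)).symm
  · simp only [hg]
    have := h3 y' x' y x (hE _ _ hxy') (hE _ _ hxy)
    omega

theorem PairSeen.reflect {V : Type*} {E : V → V → Prop} {f f' : V → ℤ} {N : ℤ} {u v : V}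
    (hE : ∀ x y, E x y → E y x) (hf : ∀ x, f' x = N - 1 - f x) (H : PairSeen E f N u v) :
    PairSeen E f' N u v := by
  obtain ⟨t, h0, h1, H⟩ := H
  have hr : ∀ x, rot N (N - t) (f' x) = 2 * N - 1 - rot N t (f x) := fun x => by
    simp only [rot, hf]; split_ifs <;> omega
  exact ⟨N - t, by omega, by omega, H.symm.imp (Sees.reverse _ hE hr) (Sees.reverse _ hE hr)⟩

/-- The vertices of a strip alternate between the two rows of a zigzag: a vertex at time `i` is put
on the row given by `ℓ i` and the parity of `i`. -/
def stripOrder {N : ℕ} (ℓ : Fin N → Bool) (i : Fin N) : ℤ :=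
  if ℓ i = decide ((i : ℕ) % 2 = 0) then (i : ℕ) else 2 * N - 1 - (i : ℕ)

/-- Exchanging the rows reverses the cyclic order, so one may assume that a chosen vertex is on the
ascending side. -/
theorem stripOrder_not {N : ℕ} (ℓ : Fin N → Bool) (i : Fin N) :
    stripOrder (fun j => !ℓ j) i = 2 * N - 1 - stripOrder ℓ i := by
  simp only [stripOrder]
  rcases Bool.eq_false_or_eq_true (ℓ i) with h' | h' <;> by_cases h : (i : ℕ) % 2 = 0 <;>
    simp [h, h']

section Strip

variable {N : ℕ} {G : SimpleGraph (Fin N)} {ℓ : Fin N → Bool}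

theorem stripOrder_injective : Function.Injective (stripOrder ℓ) := by
  intro x y h
  have := x.2; have := y.2
  simp only [stripOrder] at h
  apply Fin.ext
  split_ifs at h <;> omega

/-- From one time to the next, the side changes exactly when the row does not. -/
theorem strip_sign_succ {i n : Fin N} (hn : (n : ℕ) = i + 1)
    (hi : ℓ i = decide ((i : ℕ) % 2 = 0)) :
    (ℓ n = ℓ i ∧ ℓ n ≠ decide ((n : ℕ) % 2 = 0)) ∨
      (ℓ n ≠ ℓ i ∧ ℓ n = decide ((n : ℕ) % 2 = 0)) := by
  rw [hi]
  cases hb : ℓ n <;> rcases Nat.mod_two_eq_zero_or_one i with h | h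
  · right; simp [hn, h]; omega
  · left; simp [hn, h]; omega
  · left; simp [hn, h]; omega
  · right; simp [hn, h]; omega

/-- The cut right after `i` makes `i` last and leaves its earlier neighbours beyond `k`. If `n` is
in the row of `i`, it is the only possible later neighbour and the last of the later vertices;
otherwise `k = n` is the first of them. Either way no edge at `i` covers the pair. -/
theorem pairSeen_strip_next
    (hG : ∀ i k : Fin N, G.Adj i k → i < k → ∀ m : Fin N, i < m → m < k → ℓ m ≠ ℓ i)
    {i k n : Fin N} (hn : (n : ℕ) = i + 1) (hik : i < k) (h : ℓ n = ℓ i ∨ k = n)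
    (hi : ℓ i = decide ((i : ℕ) % 2 = 0)) : PairSeen G.Adj (stripOrder ℓ) (2 * N) i k := by
  set g : Fin N → ℤ := fun x => rot (2 * N) ((i : ℕ) + 1) (stripOrder ℓ x) with hgdef
  have gp : ∀ x, ℓ x = decide ((x : ℕ) % 2 = 0) → i < x → g x = (x : ℕ) := fun x hx hl => by
    have := x.2; rw [Fin.lt_def] at hl
    simp only [hgdef, stripOrder, rot, if_pos hx]
    split_ifs <;> omega
  have gm : ∀ x, ℓ x ≠ decide ((x : ℕ) % 2 = 0) → g x = 2 * N - 1 - (x : ℕ) := fun x hx => by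
    have := x.2; have := i.2
    simp only [hgdef, stripOrder, rot, if_neg hx]
    split_ifs <;> omega
  have gi : g i = 2 * N + (i : ℕ) := by
    have := i.2
    simp only [hgdef, stripOrder, rot, if_pos hi]
    split_ifs <;> omega
  have gb : ∀ x, i < x → g x < 2 * N ∧ (g n ≤ g x ∨ ℓ n = ℓ i) ∧ (ℓ n = ℓ i → g x ≤ g n) := by
    intro x hx
    have := x.2; have := hn; have hlt := hx
    rw [Fin.lt_def] at hlt
    by_cases px : ℓ x = decide ((x : ℕ) % 2 = 0)
    · have := gp x px hx
      rcases strip_sign_succ hn hi with ⟨h1, h2⟩ | ⟨h1, h2⟩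
      · have := gm n h2; exact ⟨by omega, Or.inr h1, fun _ => by omega⟩
      · have := gp n h2 (by rw [Fin.lt_def]; omega)
        exact ⟨by omega, Or.inl (by omega), fun h => absurd h h1⟩
    · have := gm x px
      rcases strip_sign_succ hn hi with ⟨h1, h2⟩ | ⟨h1, h2⟩
      · have := gm n h2; exact ⟨by omega, Or.inr h1, fun _ => by omega⟩
      · have := gp n h2 (by rw [Fin.lt_def]; omega)
        exact ⟨by omega, Or.inl (by omega), fun h => absurd h h1⟩
  have gle : ∀ x, g x ≤ g i := by
    intro x
    by_cases hx : i < x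
    · have := gb x hx; omega
    · rw [not_lt, Fin.le_def] at hx
      have := x.2; have := i.2
      simp only [hgdef, stripOrder, rot]
      split_ifs <;> omega
  have ginj : ∀ x, g i ≤ g x → x = i := by
    intro x hx
    by_contra hne
    have h1 := (stripOrder_injective (ℓ := ℓ)).ne hne
    have h2 := le_antisymm hx (gle x)
    have := x.2; have := i.2
    simp only [hgdef, rot, stripOrder] at h1 h2
    split_ifs at h1 h2 <;> omega
  have hnG : ∀ x, G.Adj i x → g x ≤ g k → x = k := by
    intro x hx hxk
    have hkb := gb k hik
    by_cases hxi : i < x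
    · have hxb := gb x hxi
      have inj : ∀ y, g y = g n → i < y → y = n := by
        intro y hy hiy
        have hin : i < n := by rw [Fin.lt_def]; omega
        by_cases py : ℓ y = decide ((y : ℕ) % 2 = 0) <;>
          by_cases pn : ℓ n = decide ((n : ℕ) % 2 = 0)
        · have := gp y py hiy; have := gp n pn hin; apply Fin.ext; omega
        · have := gp y py hiy; have := gm n pn; have := y.2; have := n.2; omega
        · have := gm y py; have := gp n pn hin; have := y.2; have := n.2; omega
        · have := gm y py; have := gm n pn; apply Fin.ext; omega
      by_cases hs : ℓ n = ℓ i
      · have : x = n := by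
          by_contra hne
          refine hG i x hx hxi n (by rw [Fin.lt_def]; omega) ?_ hs
          rw [Fin.lt_def] at *
          have : (x : ℕ) ≠ n := fun e => hne (Fin.ext e)
          omega
        subst this
        exact (inj k (le_antisymm (hkb.2.2 hs) hxk) hik).symm
      · have hkn := h.resolve_left hs
        subst hkn
        exact inj x (le_antisymm hxk (hxb.2.1.resolve_right hs)) hxi
    · exfalso
      have hne : x ≠ i := hx.ne'
      rw [not_lt, Fin.le_def] at hxi
      have : (x : ℕ) ≠ i := fun e => hne (Fin.ext e)
      have hbig : 2 * (N : ℤ) - 1 - (i : ℕ) < g x := by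
        have := x.2; have := i.2
        simp only [hgdef, rot, stripOrder]
        split_ifs <;> omega
      have hk : g k ≤ 2 * N - 1 - (i : ℕ) - 1 := by
        have := k.2; rw [Fin.lt_def] at hik
        by_cases pk : ℓ k = decide ((k : ℕ) % 2 = 0)
        · have := gp k pk hik; omega
        · have := gm k pk; omega
      omega
  refine ⟨(i : ℕ) + 1, by omega, by have := i.2; omega, Or.inr ⟨?_, ?_, ?_⟩⟩
  · change g k < g i
    have := gb k hik; omega
  · intro x y hxy hx hy
    obtain rfl := ginj y hy
    exact ⟨hnG x hxy.symm hx, rfl⟩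
  · intro x y x' y' _ _ _ _ _ _ _ h6
    exact absurd (gle y') (not_le.2 h6)

/-- The cut opposite to `a` puts all vertices of time at most `a` first, with `a` the last of them,
and the later ones after. Only `i` and `a`, the latest of their rows up to time `a`, can have edges
to the later part. -/
theorem pairSeen_strip_cut
    (hG : ∀ i k : Fin N, G.Adj i k → i < k → ∀ m : Fin N, i < m → m < k → ℓ m ≠ ℓ i)
    {i k a b : Fin N} (hb : (b : ℕ) = a + 1) (hia : i < a) (hak : a < k)
    (hrow : ∀ m, i < m → m ≤ a → ℓ m ≠ ℓ i) (hk : k = b ∨ ℓ b = ℓ i)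
    (ha : ℓ a = decide ((a : ℕ) % 2 = 0)) : PairSeen G.Adj (stripOrder ℓ) (2 * N) i k := by
  set g : Fin N → ℤ := fun x => rot (2 * N) (2 * N - 1 - (a : ℕ)) (stripOrder ℓ x) with hgdef
  have gp : ∀ x, ℓ x = decide ((x : ℕ) % 2 = 0) → g x = 2 * N + (x : ℕ) := fun x hx => by
    have := x.2; have := a.2; have := b.2
    simp only [hgdef, stripOrder, rot, if_pos hx]
    split_ifs <;> omega
  have gm : ∀ x, ℓ x ≠ decide ((x : ℕ) % 2 = 0) → x ≤ a → g x = 2 * N - 1 - (x : ℕ) :=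
    fun x hx hl => by
    have := x.2; rw [Fin.le_def] at hl
    simp only [hgdef, stripOrder, rot, if_neg hx]
    split_ifs <;> omega
  have gm' : ∀ x, ℓ x ≠ decide ((x : ℕ) % 2 = 0) → a < x → g x = 4 * N - 1 - (x : ℕ) :=
    fun x hx hl => by
    have := x.2; rw [Fin.lt_def] at hl
    simp only [hgdef, stripOrder, rot, if_neg hx]
    split_ifs <;> omega
  have ga := gp a ha
  have gA : ∀ x, x ≤ a → g x ≤ g a ∧ (g a ≤ g x → x = a) := by
    intro x hx
    have hx' := hx
    have := x.2; rw [Fin.le_def] at hx'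
    by_cases px : ℓ x = decide ((x : ℕ) % 2 = 0)
    · have := gp x px; exact ⟨by omega, fun h => Fin.ext (by omega)⟩
    · have := gm x px hx; exact ⟨by omega, fun h => by omega⟩
  have gB : ∀ x, a < x → g a < g x := by
    intro x hx
    have hx' := hx
    have := x.2; rw [Fin.lt_def] at hx'
    by_cases px : ℓ x = decide ((x : ℕ) % 2 = 0)
    · have := gp x px; omega
    · have := gm' x px hx; omega
  have hab : a < b := by rw [Fin.lt_def]; omega
  have hA : ∀ x, g x ≤ g a → x ≤ a := fun x h => not_lt.1 fun h' => absurd (gB x h') (not_lt.2 h)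
  have hB : ∀ x, g a < g x → a < x := fun x h => not_le.1 fun h' =>
    absurd (gA x h').1 (not_le.2 h)
  have bne : ∀ {p q r : Bool}, p ≠ q → r ≠ q → p = r := by decide
  -- Any other early vertex has `i` or `a` ahead of it in its own row, and an edge to the later part
  -- would pass over it.
  have key : ∀ x y, x ≤ a → a < y → G.Adj x y → x = i ∨ x = a := by
    intro x y hx hy hxy
    by_contra hc
    push Not at hc
    have hxa := lt_of_le_of_ne hx hc.2
    have hG' := hG x y hxy (hx.trans_lt hy)
    rcases lt_or_gt_of_ne hc.1 with h | h
    · have hi1 : ℓ i ≠ ℓ x := hG' i h (hia.trans hy)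
      have hi2 : ℓ a ≠ ℓ x := hG' a hxa hy
      exact hrow a hia le_rfl (bne hi2 hi1)
    · have hi2 : ℓ a ≠ ℓ x := hG' a hxa hy
      exact hi2 (bne (hrow a hia le_rfl) (hrow x h hx))
  have hbs := strip_sign_succ hb ha
  -- If `b` is in the row of `i`, it is the only possible later neighbour and comes first in the
  -- later part. Otherwise `k = b` comes last there.
  have hBk : ∀ y, a < y → G.Adj i y → g k ≤ g y → y = k := by
    intro y hy hiy hle
    have hyb : b ≤ y := by rw [Fin.le_def, hb]; rw [Fin.lt_def] at hy; omega
    have hkb : b ≤ k := by rw [Fin.le_def, hb]; rw [Fin.lt_def] at hak; omega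
    by_cases hs : ℓ b = ℓ i
    · have hyb' : y = b := by
        by_contra hne
        exact hG i y hiy (hia.trans hy) b (hia.trans hab) (lt_of_le_of_ne hyb (Ne.symm hne)) hs
      have hpb : ℓ b = decide ((b : ℕ) % 2 = 0) := by
        rcases hbs with h | h
        · exact absurd (h.1.symm.trans hs) (hrow a hia le_rfl)
        · exact h.2
      have := gp b hpb
      have := k.2
      rw [Fin.le_def] at hkb
      rw [hyb'] at hle ⊢
      by_cases pk : ℓ k = decide ((k : ℕ) % 2 = 0)
      · have := gp k pk; apply Fin.ext; omega
      · have := gm' k pk hak; omega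
    · have hkb' := hk.resolve_right hs
      have hpb : ℓ b ≠ decide ((b : ℕ) % 2 = 0) := by
        rcases hbs with h | h
        · exact h.2
        · exact absurd (bne hs (hrow a hia le_rfl)) h.1
      rw [hkb'] at hle ⊢
      have := gm' b hpb hab
      have := y.2
      rw [Fin.le_def] at hyb
      by_cases py : ℓ y = decide ((y : ℕ) % 2 = 0)
      · have := gp y py; omega
      · have := gm' y py hy; apply Fin.ext; omega
  have gia : g i < g a := lt_of_le_of_ne (gA i hia.le).1 fun h => hia.ne ((gA i hia.le).2 h.ge)
  refine ⟨2 * N - 1 - (a : ℕ), by have := a.2; omega, by omega, Or.inl ⟨?_, ?_, ?_⟩⟩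
  · exact gia.trans (gB k hak)
  · intro x y hxy hx hy
    have hxa := hA x (le_of_lt (lt_of_le_of_lt hx gia))
    have hya := hB y (lt_of_lt_of_le (gB k hak) hy)
    rcases key x y hxa hya hxy with rfl | rfl
    · exact ⟨rfl, hBk y hya hxy hy⟩
    · exact absurd hx (not_le.2 gia)
  · intro x y x' y' hxy hxy' h1 h2 h3 h4 h5 h6
    change g y ≤ g x'
    have hya : y ≤ a := by
      by_contra h
      rcases key x y (hA x (h1.trans gia).le) (not_le.1 h) hxy with rfl | rfl
      · exact lt_irrefl _ h1
      · exact absurd (h1.trans gia) (lt_irrefl _)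
    by_cases hx' : a < x'
    · exact ((gA y hya).1.trans_lt (gB x' hx')).le
    · have hy' : a < y' := hB y' ((gB k hak).trans h6)
      rcases key x' y' (not_lt.1 hx') hy' hxy' with rfl | rfl
      · exact absurd h4 (lt_irrefl _)
      · exact (gA y hya).1

/-- A graph whose vertices are ordered in two rows such that no edge passes over a vertex in the
row of its earlier end has a good order. -/
theorem hasGoodOrder_strip
    (hG : ∀ i k : Fin N, G.Adj i k → i < k → ∀ m : Fin N, i < m → m < k → ℓ m ≠ ℓ i) :
    HasGoodOrder G := by
  have hG' : ∀ i k : Fin N, G.Adj i k → i < k → ∀ m : Fin N, i < m → m < k →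
      (fun j => !ℓ j) m ≠ (fun j => !ℓ j) i := fun i k h1 h2 m h3 h4 h =>
    hG i k h1 h2 m h3 h4 (Bool.not_inj h)
  have hE : ∀ x y, G.Adj x y → G.Adj y x := fun _ _ h => h.symm
  have back : ∀ u v, PairSeen G.Adj (stripOrder (fun j => !ℓ j)) (2 * N) u v →
      PairSeen G.Adj (stripOrder ℓ) (2 * N) u v := fun u v H =>
    H.reflect hE fun x => by rw [stripOrder_not]; ring
  have main : ∀ i k : Fin N, i < k → PairSeen G.Adj (stripOrder ℓ) (2 * N) i k := by
    intro i k hik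
    have hlt : (i : ℕ) + 1 < N := by have := k.2; rw [Fin.lt_def] at hik; omega
    set n : Fin N := ⟨i + 1, hlt⟩
    have hn : (n : ℕ) = i + 1 := rfl
    by_cases h : ℓ n = ℓ i ∨ k = n
    · by_cases hi : ℓ i = decide ((i : ℕ) % 2 = 0)
      · exact pairSeen_strip_next hG hn hik h hi
      · exact back _ _ (pairSeen_strip_next hG' hn hik (h.imp_left fun h => by simp [h])
          (by revert hi; cases ℓ i <;> simp))
    · push Not at h
      -- `b` is the first time after `i` that is `k` or in the row of `i`; the cut is made for its
      -- predecessor `a`.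
      have hex : ∃ c, i < c ∧ (c = k ∨ ℓ c = ℓ i) := ⟨k, hik, Or.inl rfl⟩
      obtain ⟨b, ⟨hib, hbk⟩, hmin⟩ : ∃ b : Fin N, (i < b ∧ (b = k ∨ ℓ b = ℓ i)) ∧
          ∀ c, i < c ∧ (c = k ∨ ℓ c = ℓ i) → b ≤ c :=
        ⟨_, WellFounded.min_mem wellFounded_lt {c | i < c ∧ (c = k ∨ ℓ c = ℓ i)} hex,
          fun c hc => not_lt.1 (WellFounded.not_lt_min wellFounded_lt
            {c | i < c ∧ (c = k ∨ ℓ c = ℓ i)} hc)⟩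
      have hbn : b ≠ n := by
        rintro rfl
        exact hbk.elim (fun e => h.2 e.symm) h.1
      have hbn' : (b : ℕ) ≠ i + 1 := fun e => hbn (Fin.ext e)
      have hbk' : b ≤ k := hmin k ⟨hik, Or.inl rfl⟩
      rw [Fin.lt_def] at hib
      rw [Fin.le_def] at hbk'
      set a : Fin N := ⟨b - 1, by have := b.2; omega⟩
      have ha : (b : ℕ) = a + 1 := by simp only [a]; omega
      have hia : i < a := by rw [Fin.lt_def]; omega
      have hak : a < k := by rw [Fin.lt_def]; omega
      have hrow : ∀ m, i < m → m ≤ a → ℓ m ≠ ℓ i := by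
        intro m h1 h2 h3
        have := hmin m ⟨h1, Or.inr h3⟩
        rw [Fin.le_def] at this h2
        omega
      by_cases hs : ℓ a = decide ((a : ℕ) % 2 = 0)
      · exact pairSeen_strip_cut hG ha hia hak hrow (hbk.imp_left Eq.symm) hs
      · refine back _ _ (pairSeen_strip_cut hG' ha hia hak (fun m h1 h2 h3 =>
          hrow m h1 h2 (Bool.not_inj h3)) (hbk.imp Eq.symm fun h => by simp [h]) ?_)
        revert hs; cases ℓ a <;> simp
  refine ⟨stripOrder ℓ, 2 * N, stripOrder_injective, fun v => ?_, fun u v huv => ?_⟩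
  · have := v.2
    simp only [stripOrder]; split_ifs <;> omega
  · rcases lt_or_gt_of_ne huv with h | h
    · exact main u v h
    · exact (main v u h).symm

end Strip

/-! ### Faces of outerplanar drawings -/

/-- Going around a circle, `z` is strictly between `x` and `y`, where `p` gives the positions. -/
def CircBtw {V : Type*} (p : V → ℤ) (x z y : V) : Prop :=
  p x < p z ∧ p z < p y ∨ p z < p y ∧ p y < p x ∨ p y < p x ∧ p x < p z

/-- No two edges cross, for a cyclic order given by its betweenness relation. -/
def NonCrossing {V : Type*} (G : SimpleGraph V) (R : V → V → V → Prop) : Prop :=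
  ∀ a b c d, G.Adj a c → G.Adj b d → ¬ (R a b c ∧ R c d a)

/-- The inner faces, for a cyclic order given by its betweenness relation. -/
def IsFaceOf {V : Type*} (G : SimpleGraph V) (R : V → V → V → Prop) (S : Finset V) : Prop :=
  3 ≤ S.card ∧ ∀ x ∈ S, ∀ y ∈ S, x ≠ y →
    (G.Adj x y ↔ (∀ z ∈ S, ¬ R x z y) ∨ (∀ z ∈ S, ¬ R y z x))

/-- Faces and crossings depend only on `CircBtw`, so the circle may be cut before any chosen vertex
and linear inequalities used. -/
theorem exists_circBtw_eq_bot {V : Type*} [Finite V] {p : V → ℤ} (hp : Function.Injective p)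
    (x : V) : ∃ q : V → ℤ, Function.Injective q ∧ CircBtw q = CircBtw p ∧ ∀ v, q x ≤ q v := by
  obtain ⟨M, hM⟩ := (Set.finite_range p).bddAbove
  obtain ⟨m, hm⟩ := (Set.finite_range p).bddBelow
  have hM' : ∀ v, m ≤ p v ∧ p v ≤ M := fun v => ⟨hm ⟨v, rfl⟩, hM ⟨v, rfl⟩⟩
  refine ⟨fun v => rot (M - m + 1) (p x) (p v), fun u v h => hp ?_, ?_, fun v => ?_⟩
  · have := hM' u; have := hM' v; have := hM' x
    simp only [rot] at h; split_ifs at h <;> omega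
  · funext a b c
    have := hM' a; have := hM' b; have := hM' c; have := hM' x
    simp only [CircBtw, rot, eq_iff_iff]
    split_ifs <;> omega
  · have := hM' v; have := hM' x
    simp only [rot]; split_ifs <;> omega

section Faces

variable {V : Type*} {G : SimpleGraph V} {p q : V → ℤ} {S T : Finset V}

/-- The last vertex of the face up to `c` and the first one after it are consecutive, hence joined
by a side. -/
theorem IsFaceOf.exists_adj_across (hS : IsFaceOf G (CircBtw q) S) (c : ℤ) {z w : V} (hz : z ∈ S)
    (hw : w ∈ S) (hzc : q z ≤ c) (hcw : c < q w) :
    ∃ z' ∈ S, ∃ w' ∈ S, q z ≤ q z' ∧ q z' ≤ c ∧ c < q w' ∧ q w' ≤ q w ∧ G.Adj z' w' ∧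
      ∀ v ∈ S, q v ≤ q z' ∨ q w' ≤ q v := by
  obtain ⟨z', h1, h2⟩ := (S.filter fun v => q v ≤ c).exists_max_image q ⟨z, by simp [hz, hzc]⟩
  obtain ⟨w', h3, h4⟩ := (S.filter fun v => c < q v).exists_min_image q ⟨w, by simp [hw, hcw]⟩
  simp only [Finset.mem_filter] at h1 h2 h3 h4
  have hb : ∀ v ∈ S, q v ≤ q z' ∨ q w' ≤ q v := fun v hv => by
    rcases le_or_gt (q v) c with h | h
    · exact Or.inl (h2 v ⟨hv, h⟩)
    · exact Or.inr (h4 v ⟨hv, h⟩)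
  refine ⟨z', h1.1, w', h3.1, h2 z ⟨hz, hzc⟩, h1.2, h3.2, h4 w ⟨hw, hcw⟩, ?_, hb⟩
  refine (hS.2 z' h1.1 w' h3.1 ?_).2 (Or.inl fun v hv => ?_)
  · rintro rfl; omega
  · have := hb v hv
    simp only [CircBtw]; omega

theorem IsFaceOf.adj_bot_top (hS : IsFaceOf G (CircBtw q) S) {a b : V} (ha : a ∈ S) (hb : b ∈ S)
    (hab : q a < q b) (h : ∀ v ∈ S, q a ≤ q v ∧ q v ≤ q b) : G.Adj a b := by
  refine (hS.2 a ha b hb (by rintro rfl; omega)).2 (Or.inr fun v hv => ?_)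
  have := h v hv
  simp only [CircBtw]; omega

theorem IsFaceOf.between_or (hS : IsFaceOf G (CircBtw q) S) {a b : V} (ha : a ∈ S) (hb : b ∈ S)
    (hab : q a < q b) (h : G.Adj a b) :
    (∀ v ∈ S, q v ≤ q a ∨ q b ≤ q v) ∨ (∀ v ∈ S, q a ≤ q v ∧ q v ≤ q b) := by
  refine ((hS.2 a ha b hb h.ne).1 h).imp (fun h v hv => ?_) fun h v hv => ?_
  all_goals
    have := h v hv
    simp only [CircBtw] at this; omega

theorem IsFaceOf.exists_bot_top (hS : IsFaceOf G (CircBtw q) S) (hq : Function.Injective q) :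
    ∃ a ∈ S, ∃ b ∈ S, (∀ v ∈ S, q a ≤ q v ∧ q v ≤ q b) ∧ ∃ z ∈ S, q a < q z ∧ q z < q b := by
  have hne : S.Nonempty := Finset.card_pos.1 (by have := hS.1; omega)
  obtain ⟨a, ha, ha'⟩ := S.exists_min_image q hne
  obtain ⟨b, hb, hb'⟩ := S.exists_max_image q hne
  refine ⟨a, ha, b, hb, fun v hv => ⟨ha' v hv, hb' v hv⟩, ?_⟩
  by_contra hc
  push Not at hc
  classical
  have hsub : S ⊆ {a, b} := by
    intro v hv
    rcases (ha' v hv).eq_or_lt with h | h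
    · simp [hq h]
    · simp [hq (le_antisymm (hb' v hv) (hc v hv h))]
  have := Finset.card_le_card hsub
  have := Finset.card_le_two (a := a) (b := b)
  have := hS.1
  omega

theorem IsFaceOf.exists_adj_ne (hS : IsFaceOf G (CircBtw q) S) (hq : Function.Injective q)
    (a b : V) : ∃ x ∈ S, ∃ y ∈ S, G.Adj x y ∧ ¬ (x = a ∧ y = b) ∧ ¬ (x = b ∧ y = a) := by
  obtain ⟨m, hm, M, hM, h, z, hz, h1, h2⟩ := hS.exists_bot_top hq
  obtain ⟨m', hm', w, hw, e1, e2, e3, e4, e5, -⟩ := hS.exists_adj_across (q m) hm hz le_rfl h1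
  obtain rfl := hq (le_antisymm e2 e1)
  have h3 := hS.adj_bot_top hm hM (h1.trans h2) h
  by_cases hc : ¬ (m' = a ∧ w = b) ∧ ¬ (m' = b ∧ w = a)
  · exact ⟨m', hm, w, hw, e5, hc.1, hc.2⟩
  · have hwM : w ≠ M := by rintro rfl; omega
    have hmM := h3.ne
    have hmw := e5.ne
    refine ⟨m', hm, M, hM, h3, ?_, ?_⟩ <;> grind

/-- If a face had vertices on both sides of `xy`, its sides passing from one part to the other would
cross `xy` unless `x` and `y` belong to the face. But then `xy` would be a diagonal. -/
theorem IsFaceOf.side (hS : IsFaceOf G (CircBtw p) S) [Finite V] (hp : Function.Injective p)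
    (hG : NonCrossing G (CircBtw p)) {x y : V} (hxy : G.Adj x y) :
    (∀ z ∈ S, ¬ CircBtw p y z x) ∨ (∀ z ∈ S, ¬ CircBtw p x z y) := by
  obtain ⟨q, hq, hqp, hmin⟩ := exists_circBtw_eq_bot hp x
  rw [← hqp] at hS hG ⊢
  by_contra hc
  push Not at hc
  obtain ⟨⟨w, hw, hw'⟩, z, hz, hz'⟩ := hc
  have hmw := hmin w; have hmz := hmin z; have hmy := hmin y
  have hlt : q x < q y := lt_of_le_of_ne (hmin y) (hq.ne hxy.ne)
  have hyw : q y < q w := by simp only [CircBtw] at hw'; omega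
  have hxz : q x < q z ∧ q z < q y := by simp only [CircBtw] at hz'; omega
  have cross : ∀ a b, G.Adj a b → q x < q a → q a < q y → q y < q b → False :=
    fun a b hab h1 h2 h3 => hG x a y b hxy hab ⟨Or.inl ⟨h1, h2⟩, Or.inr (Or.inr ⟨h1.trans h2, h3⟩)⟩
  have hyS : y ∈ S := by
    obtain ⟨z', hz1, w', hw1, e1, e2, e3, e4, e5, -⟩ :=
      hS.exists_adj_across (q y) hz hw hxz.2.le hyw
    rcases e2.eq_or_lt with h | h
    · rwa [← hq h]
    · exact (cross z' w' e5 (by omega) h e3).elim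
  have hxS : x ∈ S := by
    obtain ⟨a, ha, b, hb, h, -⟩ := hS.exists_bot_top hq
    have haz := h z hz; have hbw := h w hw
    rcases (hmin a).eq_or_lt with h' | h'
    · rwa [hq h']
    · exact (cross a b (hS.adj_bot_top ha hb (by omega) h) h' (by omega) (by omega)).elim
  rcases hS.between_or hxS hyS hlt hxy with h | h
  · have := h z hz; omega
  · have := h w hw; omega

theorem IsFaceOf.subset_of_side (hS : IsFaceOf G (CircBtw p) S) (hT : IsFaceOf G (CircBtw p) T)
    [Finite V] (hp : Function.Injective p) (hG : NonCrossing G (CircBtw p)) {x y : V} (hxy : x ≠ y)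
    (hxS : x ∈ S) (hyS : y ∈ S) (hxT : x ∈ T) (hyT : y ∈ T) (hS' : ∀ z ∈ S, ¬ CircBtw p y z x)
    (hT' : ∀ z ∈ T, ¬ CircBtw p y z x) : S ⊆ T := by
  obtain ⟨q, hq, hqp, hmin⟩ := exists_circBtw_eq_bot hp x
  rw [← hqp] at hS hG hT hS' hT'
  have hlt : q x < q y := lt_of_le_of_ne (hmin y) (hq.ne hxy)
  have le_y : ∀ {U : Finset V}, (∀ z ∈ U, ¬ CircBtw q y z x) → ∀ z ∈ U, q z ≤ q y :=
    fun h z hz => by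
      have := h z hz; simp only [CircBtw] at this; omega
  intro z hz
  by_contra hzT
  have hzy : q z < q y := lt_of_le_of_ne (le_y hS' z hz) (hq.ne fun e => hzT (e ▸ hyT))
  obtain ⟨t, ht, t', ht', -, e2, e3, e4, e5, e6⟩ :=
    hT.exists_adj_across (q z) hxT hyT (hmin z) hzy
  have htz : q t < q z := lt_of_le_of_ne e2 (hq.ne fun e => hzT (e ▸ ht))
  -- The side `tt'` of `T` passes over `z`, so the whole face `S`, including `x` and `y`, lies under
  -- it. This leaves no room for a third vertex of `T`.
  have hin : ∀ w ∈ S, q t ≤ q w ∧ q w ≤ q t' := by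
    intro w hw
    rcases hS.side hq hG e5 with h | h
    · have := h w hw; simp only [CircBtw] at this; omega
    · have := h z hz; simp only [CircBtw] at this; omega
  have h1 := hin x hxS; have h2 := hin y hyS
  obtain ⟨a, ha, b, hb, h, w, hw, h3, h4⟩ := hT.exists_bot_top hq
  have := e6 w hw; have := hmin a; have := le_y hT' b hb; have := hmin t
  omega

theorem IsFaceOf.eq_of_side (hS : IsFaceOf G (CircBtw p) S) (hT : IsFaceOf G (CircBtw p) T)
    [Finite V] (hp : Function.Injective p) (hG : NonCrossing G (CircBtw p)) {x y : V} (hxy : x ≠ y)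
    (hxS : x ∈ S) (hyS : y ∈ S) (hxT : x ∈ T) (hyT : y ∈ T) (hS' : ∀ z ∈ S, ¬ CircBtw p y z x)
    (hT' : ∀ z ∈ T, ¬ CircBtw p y z x) : S = T :=
  (hS.subset_of_side hT hp hG hxy hxS hyS hxT hyT hS' hT').antisymm
    (hT.subset_of_side hS hp hG hxy hxT hyT hxS hyS hT' hS')

theorem eq_or_eq_of_not_circBtw (hp : Function.Injective p) {x y z : V}
    (h1 : ¬ CircBtw p y z x) (h2 : ¬ CircBtw p x z y) : x = y ∨ z = x ∨ z = y := by
  by_contra hc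
  push Not at hc
  have := hp.ne hc.1; have := hp.ne hc.2.1; have := hp.ne hc.2.2
  simp only [CircBtw] at h1 h2
  omega

/-- On either side of an edge there is a face at this edge, or the vertices on this side can be
separated into two parts with no further edge between them. -/
theorem exists_isFaceOf_or_gap [Finite V] (hq : Function.Injective q)
    (hG : NonCrossing G (CircBtw q)) {x y : V} (hxy : G.Adj x y) (hlt : q x < q y) :
    (∃ S, IsFaceOf G (CircBtw q) S ∧ x ∈ S ∧ y ∈ S) ∨ ∃ c, q x ≤ c ∧ c < q y ∧ ∀ a b, G.Adj a b →
      q x ≤ q a → q a ≤ c → c < q b → q b ≤ q y → a = x ∧ b = y := by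
  classical
  let _ := Fintype.ofFinite V
  refine or_iff_not_imp_right.2 fun hc => ?_
  push Not at hc
  -- The candidate face: the vertices from `x` to `y` not covered by any edge in this range other
  -- than `xy`.
  set S : Finset V := Finset.univ.filter fun z => q x ≤ q z ∧ q z ≤ q y ∧ ∀ a b, G.Adj a b →
    q x ≤ q a → q a < q z → q z < q b → q b ≤ q y → a = x ∧ b = y with hSdef
  have mem : ∀ z, z ∈ S ↔ q x ≤ q z ∧ q z ≤ q y ∧ ∀ a b, G.Adj a b →
      q x ≤ q a → q a < q z → q z < q b → q b ≤ q y → a = x ∧ b = y := by simp [hSdef]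
  have hx : x ∈ S := (mem x).2 ⟨le_rfl, hlt.le, fun a b _ h1 h2 => absurd h1 (not_le.2 h2)⟩
  have hy : y ∈ S := (mem y).2 ⟨hlt.le, le_rfl, fun a b _ _ _ h1 h2 => absurd h2 (not_le.2 h1)⟩
  have succ : ∀ z ∈ S, z ≠ y → ∃ w ∈ S, q z < q w ∧ G.Adj z w ∧ (z = x → w ≠ y) ∧
      ∀ v ∈ S, q v ≤ q z ∨ q w ≤ q v := by
    intro z hz hzy
    obtain ⟨z1, z2, z3⟩ := (mem z).1 hz
    obtain ⟨a, b, hab, h1, h2, h3, h4, h5⟩ := hc (q z) z1 (lt_of_le_of_ne z2 (hq.ne hzy))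
    have haz : a = z := by
      by_contra hne
      have := z3 a b hab h1 (lt_of_le_of_ne h2 (hq.ne hne)) h3 h4
      exact h5 this.1 this.2
    rw [haz] at hab h5
    -- The next vertex of the face is the farthest neighbour of `z` in range, leaving aside `xy`
    -- itself. An edge passing over it would cross `zw`, extend it, or cover `z`.
    obtain ⟨w, hw, hmax⟩ := (Finset.univ.filter fun w => G.Adj z w ∧ q z < q w ∧ q w ≤ q y ∧
      (z = x → w ≠ y)).exists_max_image q ⟨b, by simp; exact ⟨hab, h3, h4, h5⟩⟩
    simp only [Finset.mem_filter, Finset.mem_univ, true_and] at hw hmax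
    obtain ⟨w1, w2, w3, w4⟩ := hw
    refine ⟨w, (mem w).2 ⟨by omega, w3, fun c d hcd k1 k2 k3 k4 => ?_⟩, w2, w1, w4,
      fun v hv => ?_⟩
    · rcases lt_trichotomy (q c) (q z) with h | h | h
      · exact z3 c d hcd k1 h (by omega) k4
      · rw [hq h] at hcd ⊢
        by_contra hne
        have := hmax d ⟨hcd, by omega, k4, fun e e' => hne ⟨e, e'⟩⟩
        omega
      · exact (hG z c w d w1 hcd ⟨Or.inl ⟨h, k2⟩, Or.inr (Or.inr ⟨by omega, k3⟩)⟩).elim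
    · by_contra hne
      push Not at hne
      have := ((mem v).1 hv).2.2 z w w1 z1 hne.1 hne.2 w3
      exact w4 this.1 this.2
  have main : ∀ u ∈ S, ∀ v ∈ S, q u < q v →
      (G.Adj u v ↔ (∀ z ∈ S, ¬ CircBtw q u z v) ∨ (∀ z ∈ S, ¬ CircBtw q v z u)) := by
    intro u hu v hv huv
    have u1 := (mem u).1 hu; have v1 := (mem v).1 hv
    refine ⟨fun h => ?_, ?_⟩
    · by_cases he : u = x ∧ v = y
      · refine Or.inr fun z hz => ?_
        have := (mem z).1 hz
        rw [he.1, he.2]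
        simp only [CircBtw]; omega
      · refine Or.inl fun z hz hb => he ?_
        refine ((mem z).1 hz).2.2 u v h u1.1 ?_ ?_ v1.2.1
        all_goals simp only [CircBtw] at hb; omega
    · rintro (h | h)
      · obtain ⟨w, hw, w1, w2, -, w4⟩ := succ u hu (by rintro rfl; omega)
        have k1 := w4 v hv
        have k2 := h w hw
        have : w = v := hq (by simp only [CircBtw] at k2; omega)
        exact this ▸ w2
      · have k1 := h x hx; have k2 := h y hy
        simp only [CircBtw] at k1 k2
        rw [hq (show q u = q x by omega), hq (show q v = q y by omega)]
        exact hxy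
  obtain ⟨w, hw, w1, w2, w3, -⟩ := succ x hx hxy.ne
  refine ⟨S, ⟨?_, fun u hu v hv huv => ?_⟩, hx, hy⟩
  · have : ({x, w, y} : Finset V) ⊆ S := by
      intro v; simp only [Finset.mem_insert, Finset.mem_singleton]
      rintro (rfl | rfl | rfl) <;> assumption
    have h3 : ({x, w, y} : Finset V).card = 3 :=
      Finset.card_eq_three.2 ⟨x, w, y, w2.ne, hxy.ne, w3 rfl, rfl⟩
    exact h3 ▸ Finset.card_le_card this
  · rcases lt_or_gt_of_ne (hq.ne huv) with h | h
    · exact main u hu v hv h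
    · rw [G.adj_comm, or_comm]
      exact main v hv u hu h

/-- Without a face there is a gap on each side of `xy`. The two gaps split the circle into an arc
around `x` and an arc around `y`, and edges between the arcs other than `xy` would pass through a
gap or cross `xy`. -/
theorem exists_cut_of_forall_not_isFaceOf [Finite V] (hp : Function.Injective p)
    (hG : NonCrossing G (CircBtw p)) {x y : V} (hxy : G.Adj x y)
    (hn : ∀ S, IsFaceOf G (CircBtw p) S → x ∈ S → y ∉ S) :
    ∃ K : Set V, x ∉ K ∧ y ∈ K ∧ ∀ a b, G.Adj a b → a ∈ K → b ∉ K → a = y ∧ b = x := by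
  obtain ⟨q, hq, hqp, hmin⟩ := exists_circBtw_eq_bot hp x
  obtain ⟨r, hr, hrp, hrmin⟩ := exists_circBtw_eq_bot hp y
  have hlt : q x < q y := lt_of_le_of_ne (hmin y) (hq.ne hxy.ne)
  have hlt' : r y < r x := lt_of_le_of_ne (hrmin x) (hr.ne hxy.ne')
  obtain ⟨c, c1, c2, hc⟩ := (exists_isFaceOf_or_gap hq (hqp ▸ hG) hxy hlt).resolve_left
    fun ⟨S, h1, h2, h3⟩ => hn S (hqp ▸ h1) h2 h3
  obtain ⟨d, d1, d2, hd⟩ := (exists_isFaceOf_or_gap hr (hrp ▸ hG) hxy.symm hlt').resolve_left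
    fun ⟨S, h1, h2, h3⟩ => hn S (hrp ▸ h1) h3 h2
  have cmp : ∀ v, (q v < q y → q x < q v → r x < r v) ∧ (q y < q v → r v < r x) := by
    intro v
    have h : CircBtw q x v y ↔ CircBtw r x v y := by rw [hqp, hrp]
    have h' : CircBtw q y v x ↔ CircBtw r y v x := by rw [hqp, hrp]
    have := hmin v; have := hrmin v
    simp only [CircBtw] at h h'
    constructor <;> intros <;> omega
  have cross : ∀ a b, G.Adj a b → q x < q a → q a < q y → q y < q b → False :=
    fun a b hab h1 h2 h3 => hG x a y b hxy hab
      (hqp ▸ ⟨Or.inl ⟨h1, h2⟩, Or.inr (Or.inr ⟨h1.trans h2, h3⟩)⟩)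
  refine ⟨{v | c < q v ∧ q v < q y ∨ r v ≤ d}, by simp; omega, by simp; omega,
    fun a b hab ha hb => ?_⟩
  simp only [Set.mem_ofPred_eq, not_or, not_and_or, not_lt, not_le] at ha hb
  have ma := hmin a; have mb := hmin b; have na := hrmin a; have nb := hrmin b
  have ca := cmp a; have cb := cmp b
  by_cases hra : r a ≤ d
  · by_cases hbx : r b ≤ r x
    · have := hd a b hab na hra hb.2 hbx
      exact this
    · exfalso
      have hbx' : q b < q y ∧ q x < q b := by
        have h1 : b ≠ x := by rintro rfl; omega
        have h2 : b ≠ y := by rintro rfl; omega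
        have := hq.ne h1; have := hq.ne h2
        omega
      have hbc : q b ≤ c := by omega
      by_cases hay : a = y
      · subst hay
        have := hc b a hab.symm mb hbc c2 le_rfl
        rw [this.1] at hbx'; omega
      · have h3 := hq.ne hay
        have h4 : a ≠ x := by rintro rfl; omega
        have h5 := hq.ne h4
        exact cross b a hab.symm hbx'.2 hbx'.1 (by omega)
  · exfalso
    have ha' := ha.resolve_right hra
    rcases le_or_gt (q b) c with h | h
    · have := hc b a hab.symm mb h ha'.1 ha'.2.le
      rw [this.2] at ha'; omega
    · have hby : q y ≤ q b := by omega
      rcases hby.eq_or_lt with h' | h'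
      · have := hq h'
        subst this
        omega
      · exact cross a b hab (by omega) ha'.2 h'

end Faces

/-- The edges outside `F` are restored one at a time; a cut crossed by one edge of `G` remains such
a cut in the intermediate subgraphs. -/
theorem HasGoodOrder.of_cut_edges {V : Type*} [Finite V] {F G : SimpleGraph V}
    (h : ∀ x y, G.Adj x y → ¬ F.Adj x y → ∃ K : Set V, x ∉ K ∧ y ∈ K ∧
      ∀ a b, G.Adj a b → a ∈ K → b ∉ K → a = y ∧ b = x) (H : HasGoodOrder F) : HasGoodOrder G := by
  have : ∀ n, ∀ G' : SimpleGraph V, G' ≤ G → (G'.edgeSet \ F.edgeSet).ncard = n →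
      HasGoodOrder G' := by
    intro n
    induction n with
    | zero =>
      intro G' _ h0
      rw [Set.ncard_eq_zero (Set.toFinite _), Set.sdiff_eq_empty] at h0
      exact H.mono (edgeSet_subset_edgeSet.1 h0)
    | succ n ih =>
      intro G' hG' hn
      obtain ⟨e, he⟩ : (G'.edgeSet \ F.edgeSet).Nonempty := by
        rw [Set.nonempty_iff_ne_empty]; intro h0; rw [h0] at hn; simp at hn
      induction e with | _ x y =>
      obtain ⟨K, hx, hy, hK⟩ := h x y (hG' he.1) he.2
      refine HasGoodOrder.of_cut_edge K hx hy (G' := G'.deleteEdges {s(x, y)})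
        (fun a b hab hne => ?_)
        (fun a b hab => hK a b (hG' hab)) (ih _ ((deleteEdges_le _).trans hG') ?_)
      · rw [deleteEdges_adj]; exact ⟨hab, hne⟩
      · rw [edgeSet_deleteEdges, Set.sdiff_sdiff_comm,
          Set.ncard_sdiff_singleton_of_mem he, hn, Nat.add_sub_cancel]
  exact this _ G le_rfl rfl

/-! ### Outerpaths -/

/-- Times `τ` and rows `ℓ` on `U` such that no edge passes over a vertex in the row of its earlier
end, and such that `a` and `b` are the last vertices of the two rows. -/
structure IsStrip {V : Type*} (E : V → V → Prop) (U : Set V) (τ : V → ℤ) (ℓ : V → Bool)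
    (a b : V) : Prop where
  injOn : Set.InjOn τ U
  mem : ∀ u v, E u v → u ∈ U ∧ v ∈ U
  row_ne : ∀ u v, E u v → ∀ w ∈ U, τ u < τ w → τ w < τ v → ℓ w ≠ ℓ u
  left_mem : a ∈ U
  right_mem : b ∈ U
  ends_ne : ℓ a ≠ ℓ b
  le_left : ∀ w ∈ U, ℓ w = ℓ a → τ w ≤ τ a
  le_right : ∀ w ∈ U, ℓ w = ℓ b → τ w ≤ τ b

section Strip

variable {V : Type*} {G : SimpleGraph V} {p q : V → ℤ} {E E' : V → V → Prop} {U : Set V}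
  {S : Finset V} {τ : V → ℤ} {ℓ : V → Bool} {a b x y : V}

theorem IsStrip.symm (h : IsStrip E U τ ℓ a b) : IsStrip E U τ ℓ b a :=
  ⟨h.1, h.2, h.3, h.5, h.4, h.6.symm, h.8, h.7⟩

theorem IsStrip.le_max (h : IsStrip E U τ ℓ a b) : ∀ w ∈ U, τ w ≤ max (τ a) (τ b) := by
  have bne : ∀ p q r : Bool, p ≠ q → r = p ∨ r = q := by decide
  intro w hw
  rcases bne _ _ (ℓ w) h.ends_ne with h' | h'
  · exact le_max_of_le_left (h.le_left w hw h')
  · exact le_max_of_le_right (h.le_right w hw h')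

/-- The last edge of a strip can be extended by a face. -/
theorem IsStrip.extend_of_bot_top [Finite V] (hs : IsStrip E U τ ℓ a b)
    (hq : Function.Injective q) (hS : IsFaceOf G (CircBtw q) S) (haS : a ∈ S) (hbS : b ∈ S)
    (hU : ∀ v ∈ S, v ∈ U → v = a ∨ v = b) (hab : ∀ v ∈ S, q a ≤ q v ∧ q v ≤ q b)
    (hE' : ∀ u v, E' u v → E u v ∨ (G.Adj u v ∧ u ∈ S ∧ v ∈ S)) (hx : x ∈ S) (hy : y ∈ S)
    (hxy : G.Adj x y) (hlt : q x < q y) (hne : ¬ (x = a ∧ y = b)) :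
    ∃ τ' ℓ', IsStrip E' (U ∪ S) τ' ℓ' x y := by
  classical
  obtain ⟨M, hM⟩ : ∃ M : ℤ, ∀ v, q v < M := by
    obtain ⟨M, hM⟩ := (Set.finite_range q).bddAbove
    exact ⟨M + 1, fun v => Int.lt_add_one_of_le (hM ⟨v, rfl⟩)⟩
  -- Time `T + q a` separates old vertices from new ones.
  obtain ⟨T, hT⟩ : ∃ T : ℤ, ∀ v ∈ U, τ v < T + q a :=
    ⟨max (τ a) (τ b) + 1 - q a, fun v hv => by have := hs.le_max v hv; omega⟩
  -- The new vertices from `a` up to `x` join the row of `a` in ascending order. Then those from `b`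
  -- down to `y` join the row of `b`. The shift `2 * M` puts the second group later.
  set τ' : V → ℤ := fun v => if v ∈ U then τ v else if q v ≤ q x then T + q v else
    T + 2 * M - q v with hτ'
  set ℓ' : V → Bool := fun v => if v ∈ U then ℓ v else if q v ≤ q x then ℓ a else ℓ b with hℓ'
  have τU : ∀ v, v ∈ U → τ' v = τ v := fun v hv => by simp only [hτ', if_pos hv]
  have ℓU : ∀ v, v ∈ U → ℓ' v = ℓ v := fun v hv => by simp only [hℓ', if_pos hv]
  have τa : ∀ v, v ∉ U → q v ≤ q x → τ' v = T + q v := fun v hv h => by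
    simp only [hτ', if_neg hv, if_pos h]
  have τb : ∀ v, v ∉ U → q x < q v → τ' v = T + 2 * M - q v := fun v hv h => by
    simp only [hτ', if_neg hv, if_neg (not_le.2 h)]
  have hxb : q x < q b := hlt.trans_le (hab y hy).2
  have ℓa : ∀ v ∈ S, q v ≤ q x → ℓ' v = ℓ a := fun v hv h => by
    by_cases hvU : v ∈ U
    · rw [ℓU v hvU]
      rcases hU v hv hvU with rfl | rfl
      · rfl
      · exact absurd h (not_le.2 hxb)
    · simp only [hℓ', if_neg hvU, if_pos h]
  have ℓb : ∀ v ∈ S, q x < q v → ℓ' v = ℓ b := fun v hv h => by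
    by_cases hvU : v ∈ U
    · rw [ℓU v hvU]
      rcases hU v hv hvU with rfl | rfl
      · exact absurd h (not_lt.2 (hab x hx).1)
      · rfl
    · simp only [hℓ', if_neg hvU, if_neg (not_le.2 h)]
  have new : ∀ v ∈ S, v ∉ U → T + q a ≤ τ' v := fun v hv hvU => by
    have := hab v hv; have := hM v
    rcases le_or_gt (q v) (q x) with h | h
    · rw [τa v hvU h]; omega
    · rw [τb v hvU h]; have := hM a; omega
  have old : ∀ v ∈ U, τ' v < T + q a := fun v hv => (τU v hv).symm ▸ hT v hv
  have hgap : ∀ v ∈ S, q v ≤ q x ∨ q y ≤ q v := by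
    rcases hS.between_or hx hy hlt hxy with h | h
    · exact h
    · refine absurd ⟨hq ?_, hq ?_⟩ hne
      · exact le_antisymm (h a haS).1 (hab x hx).1
      · exact le_antisymm (hab y hy).2 (h b hbS).2
  refine ⟨τ', ℓ', ⟨?_, ?_, ?_, Or.inr hx, Or.inr hy, ?_, ?_, ?_⟩⟩
  · intro u hu v hv huv
    by_cases huU : u ∈ U <;> by_cases hvU : v ∈ U
    · rw [τU u huU, τU v hvU] at huv
      exact hs.injOn huU hvU huv
    · have := old u huU; have := new v (hv.resolve_left hvU) hvU; omega
    · have := old v hvU; have := new u (hu.resolve_left huU) huU; omega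
    · have := hM u; have := hM v; have := hM x
      apply hq
      rcases le_or_gt (q u) (q x) with h | h <;> rcases le_or_gt (q v) (q x) with h' | h'
      · rw [τa u huU h, τa v hvU h'] at huv; omega
      · rw [τa u huU h, τb v hvU h'] at huv; omega
      · rw [τb u huU h, τa v hvU h'] at huv; omega
      · rw [τb u huU h, τb v hvU h'] at huv; omega
  · intro u v huv
    rcases hE' u v huv with h | h
    · exact (hs.mem u v h).imp Or.inl Or.inl
    · exact ⟨Or.inr h.2.1, Or.inr h.2.2⟩
  · intro u v huv w hw h1 h2 hl
    rcases hE' u v huv with h | ⟨huv, hu, hv⟩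
    · obtain ⟨hu, hv⟩ := hs.mem u v h
      have hwU : w ∈ U := by
        by_contra hwU
        have := old v hv; have := new w (hw.resolve_left hwU) hwU; omega
      rw [ℓU u hu, ℓU w hwU] at hl
      rw [τU u hu, τU w hwU] at h1
      rw [τU v hv, τU w hwU] at h2
      exact hs.row_ne u v h w hwU h1 h2 hl
    · have hwU : w ∉ U := by
        intro hwU
        have huU : u ∈ U := by
          by_contra huU
          have := old w hwU; have := new u hu huU; omega
        rw [ℓU u huU, ℓU w hwU] at hl
        rw [τU u huU, τU w hwU] at h1
        rcases hU u hu huU with rfl | rfl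
        · exact absurd (hs.le_left w hwU hl) (not_le.2 h1)
        · exact absurd (hs.le_right w hwU hl) (not_le.2 h1)
      have hvU : v ∉ U := by
        intro hvU
        have := old v hvU; have := new w (hw.resolve_left hwU) hwU; omega
      replace hw := hw.resolve_left hwU
      have hau := hab u hu; have hav := hab v hv
      rcases le_or_gt (q w) (q x) with h | h
      · rw [ℓa w hw h] at hl
        have hux : q u ≤ q x := by
          by_contra hc
          rw [ℓb u hu (not_le.1 hc)] at hl
          exact hs.ends_ne hl
        have huw : q u < q w := by
          rw [τa w hwU h] at h1
          by_cases huU : u ∈ U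
          · rcases hU u hu huU with rfl | rfl
            · exact lt_of_le_of_ne (hab w hw).1 (hq.ne fun e => hwU (e ▸ huU))
            · omega
          · rw [τa u huU hux] at h1; omega
        have hwv : q w < q v := by
          rcases le_or_gt (q v) (q x) with h' | h'
          · rw [τa v hvU h', τa w hwU h] at h2; omega
          · omega
        rcases hS.between_or hu hv (huw.trans hwv) huv with h' | h'
        · have := h' w hw; omega
        · have := h' b hbS
          exact hvU ((hq (le_antisymm hav.2 this.2)) ▸ hs.right_mem)
      · rw [ℓb w hw h] at hl
        have hux : q x < q u := by
          by_contra hc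
          rw [ℓa u hu (not_lt.1 hc)] at hl
          exact hs.ends_ne hl.symm
        have huw : q w < q u := by
          rw [τb w hwU h] at h1
          by_cases huU : u ∈ U
          · rcases hU u hu huU with rfl | rfl
            · have := hab x hx; omega
            · exact lt_of_le_of_ne (hab w hw).2 (hq.ne fun e => hwU (e ▸ huU))
          · rw [τb u huU hux] at h1; omega
        have hwv : q v < q w ∧ q x < q v := by
          have := hM w; have := hM x
          rw [τb w hwU h] at h2
          rcases le_or_gt (q v) (q x) with h' | h'
          · rw [τa v hvU h'] at h2; omega
          · rw [τb v hvU h'] at h2; omega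
        rcases hS.between_or hv hu (hwv.1.trans huw) huv.symm with h' | h'
        · have := h' w hw; omega
        · have := h' a haS; have := hab x hx; omega
  · rw [ℓa x hx le_rfl, ℓb y hy hlt]; exact hs.ends_ne
  · intro w hw hl
    rw [ℓa x hx le_rfl] at hl
    by_cases hwU : w ∈ U
    · by_cases hxU : x ∈ U
      · have hxa : x = a := (hU x hx hxU).resolve_right (by rintro rfl; omega)
        rw [ℓU w hwU] at hl
        rw [τU w hwU, τU x hxU, hxa]
        exact hs.le_left w hwU hl
      · exact ((old w hwU).trans_le (new x hx hxU)).le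
    · replace hw := hw.resolve_left hwU
      have hwx : q w ≤ q x := by
        by_contra hc
        rw [ℓb w hw (not_le.1 hc)] at hl
        exact hs.ends_ne hl.symm
      have hxU : x ∉ U := fun hxU => by
        have hxa : x = a := (hU x hx hxU).resolve_right (by rintro rfl; omega)
        rw [hxa] at hwx hxU
        exact hwU (hq (le_antisymm hwx (hab w hw).1) ▸ hxU)
      rw [τa w hwU hwx, τa x hxU le_rfl]; omega
  · intro w hw hl
    rw [ℓb y hy hlt] at hl
    by_cases hwU : w ∈ U
    · by_cases hyU : y ∈ U
      · have hyb : y = b := (hU y hy hyU).resolve_left (by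
          rintro rfl; have := hab x hx; omega)
        rw [ℓU w hwU] at hl
        rw [τU w hwU, τU y hyU, hyb]
        exact hs.le_right w hwU hl
      · exact ((old w hwU).trans_le (new y hy hyU)).le
    · replace hw := hw.resolve_left hwU
      have hwx : q x < q w := by
        by_contra hc
        rw [ℓa w hw (not_lt.1 hc)] at hl
        exact hs.ends_ne hl
      have hyw := (hgap w hw).resolve_left (not_le.2 hwx)
      have hyU : y ∉ U := fun hyU => by
        have hyb : y = b := (hU y hy hyU).resolve_left (by
          rintro rfl; have := hab x hx; omega)
        rw [hyb] at hyw hyU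
        exact hwU (hq (le_antisymm hyw (hab w hw).2) ▸ hyU)
      rw [τb w hwU hwx, τb y hyU hlt]; omega

theorem IsStrip.extend [Finite V] (hs : IsStrip E U τ ℓ a b)
    (hp : Function.Injective p) (hS : IsFaceOf G (CircBtw p) S) (haS : a ∈ S) (hbS : b ∈ S)
    (hab : G.Adj a b) (hU : ∀ v ∈ S, v ∈ U → v = a ∨ v = b)
    (hE' : ∀ u v, E' u v → E u v ∨ (G.Adj u v ∧ u ∈ S ∧ v ∈ S)) (hx : x ∈ S) (hy : y ∈ S)
    (hxy : G.Adj x y) (hne : ¬ (x = a ∧ y = b)) (hne' : ¬ (x = b ∧ y = a)) :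
    ∃ τ' ℓ', IsStrip E' (U ∪ S) τ' ℓ' x y := by
  wlog h : ∀ z ∈ S, ¬ CircBtw p b z a generalizing a b
  · have h' := ((hS.2 a haS b hbS hab.ne).1 hab).resolve_right h
    exact this hs.symm hbS haS hab.symm (fun v h1 h2 => (hU v h1 h2).symm) hne' hne h'
  obtain ⟨q, hq, hqp, hmin⟩ := exists_circBtw_eq_bot hp a
  rw [← hqp] at hS h
  have hlt : q a < q b := lt_of_le_of_ne (hmin b) (hq.ne hab.ne)
  have hab' : ∀ v ∈ S, q a ≤ q v ∧ q v ≤ q b := fun v hv => by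
    have h1 := h v hv; have := hmin v
    simp only [CircBtw] at h1; omega
  rcases lt_or_gt_of_ne (hq.ne hxy.ne) with hlt | hlt
  · exact hs.extend_of_bot_top hq hS haS hbS hU hab' hE' hx hy hxy hlt hne
  · obtain ⟨τ', ℓ', h'⟩ := hs.extend_of_bot_top hq hS haS hbS hU hab' hE' hy hx hxy.symm hlt
      fun ⟨h1, h2⟩ => hne' ⟨h2, h1⟩
    exact ⟨τ', ℓ', h'.symm⟩

theorem IsStrip.hasGoodOrder [Finite V] {F : SimpleGraph V} (hs : IsStrip F.Adj U τ ℓ a b) :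
    HasGoodOrder F := by
  classical
  let _ := Fintype.ofFinite U
  obtain ⟨σ, hσ⟩ := exists_equiv_fin_lt_iff (f := fun u : U => τ u)
    fun u v h => Subtype.ext (hs.injOn u.2 v.2 h)
  have hlt : ∀ i k, i < k ↔ τ (σ.symm i) < τ (σ.symm k) := fun i k => by
    rw [← hσ, σ.apply_symm_apply, σ.apply_symm_apply]
  have hstrip : HasGoodOrder (F.comap fun i => (σ.symm i : V)) :=
    hasGoodOrder_strip (ℓ := fun i => ℓ (σ.symm i)) fun i k hik _ m h1 h2 =>
      hs.row_ne _ _ hik _ (σ.symm m).2 ((hlt _ _).1 h1) ((hlt _ _).1 h2)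
  -- Vertices outside `U` are isolated, so they may be thrown into the fibre of `a`.
  refine HasGoodOrder.glue (G' := ⊥) (fun v => if h : v ∈ U then σ ⟨v, h⟩ else
    σ ⟨a, hs.left_mem⟩) (fun i => (σ.symm i : V)) (fun c => by simp) (fun u v huv => Or.inr ?_)
    hasGoodOrder_bot hstrip
  obtain ⟨hu, hv⟩ := hs.mem u v huv
  simp [hu, hv]

end Strip

/-- In a path of faces, the faces before an edge shared by two consecutive ones lie on one side of
this edge. -/
theorem eq_or_eq_of_mem_faces {V : Type*} [Finite V] {G : SimpleGraph V} {p : V → ℤ}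
    (hp : Function.Injective p) (hG : NonCrossing G (CircBtw p)) {m : ℕ} {S : ℕ → Finset V}
    (hS : ∀ i < m, IsFaceOf G (CircBtw p) (S i)) (hinj : ∀ i < m, ∀ j < m, S i = S j → i = j)
    (hadj : ∀ i, i + 1 < m → ∃ x y, G.Adj x y ∧ x ∈ S i ∧ y ∈ S i ∧ x ∈ S (i + 1) ∧ y ∈ S (i + 1))
    {j : ℕ} (hj : j + 1 < m) {a b : V} (hab : G.Adj a b) (haj : a ∈ S j) (hbj : b ∈ S j)
    (ha : a ∈ S (j + 1)) (hb : b ∈ S (j + 1)) :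
    ∀ i ≤ j, (∀ v ∈ S i, v ∈ S (j + 1) → v = a ∨ v = b) ∧ (i < j → a ∈ S i → b ∉ S i) := by
  wlog hside : ∀ z ∈ S (j + 1), ¬ CircBtw p b z a generalizing a b
  · have h := ((hS _ hj).side hp hG hab).resolve_left hside
    intro i hi
    obtain ⟨h1, h2⟩ := this hab.symm hbj haj hb ha h i hi
    exact ⟨fun v hv hv' => (h1 v hv hv').symm, fun h h' h'' => h2 h h'' h'⟩
  -- On the other side, the face would be the face `S (j + 1)` by uniqueness of the face on a side
  -- of an edge.
  have opp : ∀ i ≤ j, a ∈ S i → b ∈ S i → ∀ z ∈ S i, ¬ CircBtw p a z b := by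
    intro i hi hai hbi
    refine ((hS i (by omega)).side hp hG hab).resolve_left fun h => ?_
    have := hinj _ (by omega) _ hj
      ((hS i (by omega)).eq_of_side (hS _ hj) hp hG hab.ne hai hbi ha hb h hside)
    omega
  -- Going down the path: if `S i` and `S (i + 1)` lay on different sides of `ab`, their common edge
  -- could only be `ab`, and `S i` would be `S (j + 1)`.
  have main : ∀ k i, i + k = j → ∀ z ∈ S i, ¬ CircBtw p a z b := by
    intro k
    induction k with
    | zero => rintro i rfl; exact opp _ le_rfl haj hbj
    | succ k ih =>
      intro i hik
      have h1 := ih (i + 1) (by omega)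
      refine ((hS i (by omega)).side hp hG hab).resolve_left fun h => ?_
      obtain ⟨x, y, hxy, hx, hy, hx', hy'⟩ := hadj i (by omega)
      have ex := (eq_or_eq_of_not_circBtw hp (h x hx) (h1 x hx')).resolve_left hab.ne
      have ey := (eq_or_eq_of_not_circBtw hp (h y hy) (h1 y hy')).resolve_left hab.ne
      have hne := hxy.ne
      have hmem : a ∈ S i ∧ b ∈ S i := by
        rcases ex with rfl | rfl <;> rcases ey with rfl | rfl
        · exact absurd rfl hne
        · exact ⟨hx, hy⟩
        · exact ⟨hy, hx⟩
        · exact absurd rfl hne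
      have := hinj _ (by omega) _ hj
        ((hS i (by omega)).eq_of_side (hS _ hj) hp hG hab.ne hmem.1 hmem.2 ha hb h hside)
      omega
  intro i hi
  have hi' := main (j - i) i (by omega)
  refine ⟨fun v hv hv' => (eq_or_eq_of_not_circBtw hp (hside v hv') (hi' v hv)).resolve_left
    hab.ne, fun hlt h1 h2 => ?_⟩
  have := hinj _ (by omega) _ (by omega) ((hS i (by omega)).eq_of_side (hS j (by omega)) hp hG
    hab.symm.ne h2 h1 hbj haj hi' (main 0 j rfl))
  omega

/-- The edges of the first faces in a path of faces form a strip. -/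
theorem exists_isStrip_faces {V : Type*} [Finite V] {G : SimpleGraph V} {p : V → ℤ}
    (hp : Function.Injective p) (hG : NonCrossing G (CircBtw p)) {m : ℕ} {S : ℕ → Finset V}
    (hS : ∀ i < m, IsFaceOf G (CircBtw p) (S i)) (hinj : ∀ i < m, ∀ j < m, S i = S j → i = j)
    (hadj : ∀ i, i + 1 < m → ∃ x y, G.Adj x y ∧ x ∈ S i ∧ y ∈ S i ∧ x ∈ S (i + 1) ∧ y ∈ S (i + 1))
    (j : ℕ) (hj : j < m) : ∀ x ∈ S j, ∀ y ∈ S j, G.Adj x y →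
      (∀ i, i + 1 = j → x ∈ S i → y ∉ S i) →
      ∃ τ ℓ, IsStrip (fun u v => G.Adj u v ∧ ∃ i ≤ j, u ∈ S i ∧ v ∈ S i) {v | ∃ i ≤ j, v ∈ S i}
        τ ℓ x y := by
  classical
  induction j with
  | zero =>
    intro x hx y hy hxy _
    obtain ⟨a, ha, b, hb, hab, h1, h2⟩ := (hS 0 hj).exists_adj_ne hp x y
    -- The initial strip is one edge of the first face different from the exit edge `xy`, so that
    -- `extend` applies.
    have hs : IsStrip (fun u v => u = a ∧ v = b ∨ u = b ∧ v = a) {a, b}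
        (fun v => if v = a then 0 else 1) (fun v => decide (v = a)) a b := by
      have := hab.ne
      constructor <;> simp [Set.InjOn] <;> grind
    obtain ⟨τ, ℓ, h⟩ := hs.extend (E' := fun u v => G.Adj u v ∧ ∃ i ≤ 0, u ∈ S i ∧ v ∈ S i) hp
      (hS 0 hj) ha hb hab (fun v _ h => h)
      (fun u v ⟨huv, i, hi, h⟩ => Or.inr ⟨huv, by rwa [Nat.le_zero.1 hi] at h⟩) hx hy hxy
      (fun h => h1 ⟨h.1.symm, h.2.symm⟩) (fun h => h2 ⟨h.2.symm, h.1.symm⟩)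
    refine ⟨τ, ℓ, ?_⟩
    convert h using 1
    ext v
    simp only [Set.mem_ofPred_eq, Set.mem_union, Set.mem_insert_iff, Set.mem_singleton_iff,
      Nat.le_zero, exists_eq_left, Finset.mem_coe]
    grind
  | succ j ih =>
    intro x hx y hy hxy hn
    obtain ⟨a, b, hab, haj, hbj, ha, hb⟩ := hadj j hj
    have key := eq_or_eq_of_mem_faces hp hG hS hinj hadj hj hab haj hbj ha hb
    obtain ⟨τ, ℓ, hs⟩ := ih (by omega) a haj b hbj hab
      fun i hi => (key i (by omega)).2 (by omega)
    have hn' := hn j rfl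
    have hE' : ∀ u v, (G.Adj u v ∧ ∃ i ≤ j + 1, u ∈ S i ∧ v ∈ S i) →
        (G.Adj u v ∧ ∃ i ≤ j, u ∈ S i ∧ v ∈ S i) ∨ (G.Adj u v ∧ u ∈ S (j + 1) ∧ v ∈ S (j + 1)) := by
      rintro u v ⟨huv, i, hi, h⟩
      rcases hi.lt_or_eq with h' | rfl
      · exact Or.inl ⟨huv, i, by omega, h⟩
      · exact Or.inr ⟨huv, h⟩
    obtain ⟨τ', ℓ', h⟩ := hs.extend (E' := fun u v => G.Adj u v ∧ ∃ i ≤ j + 1, u ∈ S i ∧ v ∈ S i)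
      hp (hS _ hj) ha hb hab (fun v hv ⟨i, hi, h⟩ => (key i hi).1 v h hv) hE' hx hy hxy
      (by rintro ⟨rfl, rfl⟩; exact hn' haj hbj) (by rintro ⟨rfl, rfl⟩; exact hn' hbj haj)
    refine ⟨τ', ℓ', ?_⟩
    convert h using 1
    ext v
    simp only [Set.mem_ofPred_eq, Set.mem_union, Finset.mem_coe]
    constructor
    · rintro ⟨i, hi, h⟩
      rcases hi.lt_or_eq with h' | rfl
      · exact Or.inl ⟨i, by omega, h⟩
      · exact Or.inr h
    · rintro (⟨i, hi, h⟩ | h)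
      · exact ⟨i, by omega, h⟩
      · exact ⟨_, le_rfl, h⟩

theorem hasGoodOrder_of_face_path {V : Type*} [Finite V] {G : SimpleGraph V} {p : V → ℤ}
    (hp : Function.Injective p) (hG : NonCrossing G (CircBtw p)) {m : ℕ} {S : ℕ → Finset V}
    (hS : ∀ i < m, IsFaceOf G (CircBtw p) (S i)) (hinj : ∀ i < m, ∀ j < m, S i = S j → i = j)
    (hsurj : ∀ T, IsFaceOf G (CircBtw p) T → ∃ i < m, S i = T)
    (hadj : ∀ i, i + 1 < m → ∃ x y, G.Adj x y ∧ x ∈ S i ∧ y ∈ S i ∧ x ∈ S (i + 1) ∧ y ∈ S (i + 1)) :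
    HasGoodOrder G := by
  rcases m with _ | m
  · refine HasGoodOrder.of_cut_edges (F := ⊥) (fun x y hxy _ => ?_) hasGoodOrder_bot
    refine exists_cut_of_forall_not_isFaceOf hp hG hxy fun T hT => ?_
    obtain ⟨i, hi, -⟩ := hsurj T hT
    exact absurd hi (Nat.not_lt_zero i)
  · have hm : m < m + 1 := Nat.lt_succ_self m
    -- The strip needs an exit edge of the last face that is not shared with the previous one.
    obtain ⟨x, hx, y, hy, hxy, hn⟩ : ∃ x ∈ S m, ∃ y ∈ S m, G.Adj x y ∧
        ∀ i, i + 1 = m → x ∈ S i → y ∉ S i := by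
      rcases m with _ | m
      · have h0 := hS 0 hm
        obtain ⟨a, ha, -⟩ := h0.exists_bot_top hp
        obtain ⟨x, hx, y, hy, hxy, -⟩ := h0.exists_adj_ne hp a a
        exact ⟨x, hx, y, hy, hxy, fun i hi => absurd hi (Nat.succ_ne_zero i)⟩
      · obtain ⟨a, b, hab, haj, hbj, ha, hb⟩ := hadj m hm
        have key := (eq_or_eq_of_mem_faces hp hG hS hinj hadj hm hab haj hbj ha hb m le_rfl).1
        obtain ⟨x, hx, y, hy, hxy, h1, h2⟩ := (hS _ hm).exists_adj_ne hp a b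
        refine ⟨x, hx, y, hy, hxy, fun i hi hxi hyi => ?_⟩
        obtain rfl : i = m := by omega
        have := key x hxi hx; have := key y hyi hy; have := hxy.ne
        grind
    obtain ⟨τ, ℓ, hs⟩ := exists_isStrip_faces hp hG hS hinj hadj m hm x hx y hy hxy hn
    let F : SimpleGraph V :=
      { Adj := fun u v => G.Adj u v ∧ ∃ i ≤ m, u ∈ S i ∧ v ∈ S i
        symm := ⟨fun u v ⟨h, i, hi, hu, hv⟩ => ⟨h.symm, i, hi, hv, hu⟩⟩
        loopless := ⟨fun u h => h.1.ne rfl⟩ }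
    refine HasGoodOrder.of_cut_edges (F := F) (fun u v huv hF => ?_) (IsStrip.hasGoodOrder hs)
    refine exists_cut_of_forall_not_isFaceOf hp hG huv fun T hT hu hv => hF ⟨huv, ?_⟩
    obtain ⟨i, hi, rfl⟩ := hsurj T hT
    exact ⟨i, by omega, hu, hv⟩

theorem IsOuterpath.hasGoodOrder {V : Type*} [Fintype V] {G : SimpleGraph V}
    (h : IsOuterpath G) : HasGoodOrder G := by
  obtain ⟨σ, hσ, m, ⟨e⟩⟩ := h
  set p : V → ℤ := fun v => ((σ v : ℕ) : ℤ)
  have hp : Function.Injective p := fun u v h => σ.injective (Fin.ext (Int.ofNat_inj.1 h))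
  have hR : (fun a b c => sbtw (σ a) (σ b) (σ c)) = CircBtw p := by
    funext a b c
    change (σ a < σ b ∧ σ b < σ c ∨ σ b < σ c ∧ σ c < σ a ∨ σ c < σ a ∧ σ a < σ b) = _
    simp only [CircBtw, p, Nat.cast_lt, Fin.lt_def]
  have hG : NonCrossing G (CircBtw p) := by rw [← hR]; exact hσ
  have hface : ∀ T, IsFaceOf G (CircBtw p) T ↔ IsInnerFace G σ T := by
    rw [← hR]; exact fun _ => Iff.rfl
  refine hasGoodOrder_of_face_path hp hG (m := m)
    (S := fun i => if h : i < m then (e.symm ⟨i, h⟩).1 else ∅) ?_ ?_ ?_ ?_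
  · intro i hi
    rw [hface]
    simpa only [hi, dif_pos] using (e.symm ⟨i, hi⟩).2
  · intro i hi j hj hij
    simp only [hi, hj, dif_pos] at hij
    simpa using e.symm.injective (Subtype.ext hij)
  · intro T hT
    refine ⟨e ⟨T, (hface T).1 hT⟩, (e _).2, ?_⟩
    simp
  · intro i hi
    have hadj : (weakDual G σ).Adj (e.symm ⟨i, by omega⟩) (e.symm ⟨i + 1, hi⟩) := by
      rw [e.symm.map_adj_iff, pathGraph_adj]
      exact Or.inl rfl
    simpa only [hi, show i < m by omega, dif_pos] using hadj.2

theorem mainTheorem4 {V : Type*} [Fintype V] (G : SimpleGraph V) :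
    (IsCactus G → HasReducibleRegularOOR G) ∧
    (IsGrid G → HasReducibleRegularOOR G) ∧
    (IsOuterpath G → HasReducibleRegularOOR G) :=
  ⟨fun h => h.hasGoodOrder.hasReducibleRegularOOR, fun h => h.hasGoodOrder.hasReducibleRegularOOR,
    fun h => h.hasGoodOrder.hasReducibleRegularOOR⟩
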